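/- Let $G$ be a finite-dimensional real (smooth) Lie group, not necessarily connected, with Lie algebra $\mathcal G$. Let $\nabla$ be the canonical Cartan–Schouten connection of $G$, i.e. the affine connection determined by $\nabla_{x^+}y^+=\tfrac12[x^+,y^+]$ for all left invariant vector fields $x^+,y^+$. A Cartan–Schouten metric on $G$ is a smooth field $\mu$ of nondegenerate symmetric bilinear forms on the tangent spaces of $G$ such that $\nabla\mu=0$, i.e. $X\cdot\mu(Y,Z)=\mu(\nabla_XY,Z)+\mu(Y,\nabla_XZ)$ for all vector fields $X,Y,Z$. As usual, $G$ is called solvable, Abelian, or 2-step nilpotent when its Lie algebra is; $\mathcal G$ is 2-step nilpotent when it is non-Abelian and $[\mathcal G,\mathcal G]$ is contained in the center of $\mathcal G$. **Theorem.** Suppose that $G$ is solvable and non-Abelian. Then the following are equivalent: 1. $G$ admits a positive definite Cartan–Schouten metric; 2. $G$ admits a negative definite Cartan–Schouten metric; 3. $G$ is 2-step nilpotent. -/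

import Mathlib

open Bundle NormedSpace
open scoped Manifold ContDiff

noncomputable section

namespace CartanSchouten

/-- A smooth Lie group has enough regularity to carry Mathlib's Lie algebra structure on its tangent
space at the unit. -/
instance lieGroupMinSmoothness {E : Type*} [NormedAddCommGroup E] [NormedSpace ℝ E]
    {G : Type*} [TopologicalSpace G] [ChartedSpace E G] [Group G] [LieGroup 𝓘(ℝ, E) ∞ G] :
    LieGroup 𝓘(ℝ, E) (minSmoothness ℝ 3) G :=
  LieGroup.of_le (n := ∞) (by
    simp only [minSmoothness_of_isRCLikeNormedField]; exact ENat.LEInfty.out)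

section

variable {E : Type*} [NormedAddCommGroup E] [NormedSpace ℝ E]
  {G : Type*} [TopologicalSpace G] [ChartedSpace E G] [Group G]

/-- The differential at `g` of left translation by `g⁻¹`, which identifies the tangent space at `g`
with the Lie algebra (the left Maurer-Cartan form). -/
def leftTriv (g : G) : TangentSpace 𝓘(ℝ, E) g →L[ℝ] GroupLieAlgebra 𝓘(ℝ, E) G :=
  mfderiv 𝓘(ℝ, E) 𝓘(ℝ, E) (fun h : G => g⁻¹ * h) g

/-- A vector field on `G`, read through the left trivialization as a function from `G` to the Lie
algebra (whose underlying vector space is `E`). -/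
def leftTrivField (Y : Π h : G, TangentSpace 𝓘(ℝ, E) h) : G → E :=
  fun h => leftTriv h (Y h)

/-- The differential at `g` of a vector field read in the left trivialization. -/
def leftTrivDeriv (Y : Π h : G, TangentSpace 𝓘(ℝ, E) h) (g : G) :
    TangentSpace 𝓘(ℝ, E) g →L[ℝ] GroupLieAlgebra 𝓘(ℝ, E) G :=
  mvfderiv 𝓘(ℝ, E) (leftTrivField Y) g

end

section

variable {E : Type*} [NormedAddCommGroup E] [NormedSpace ℝ E]
  {G : Type*} [TopologicalSpace G] [ChartedSpace E G] [Group G] [LieGroup 𝓘(ℝ, E) ∞ G]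

theorem mdifferentiableAt_mul_left (a b : G) :
    MDifferentiableAt 𝓘(ℝ, E) 𝓘(ℝ, E) (fun h : G => a * h) b :=
  (contMDiff_mul_left (I := 𝓘(ℝ, E)) (n := ∞)).contMDiffAt.mdifferentiableAt (by simp)

theorem leftTriv_mulInvariantVectorField (g : G) (v : GroupLieAlgebra 𝓘(ℝ, E) G) :
    leftTriv g (mulInvariantVectorField v g) = v := by
  have h1 := mfderiv_comp_apply_of_eq (I := 𝓘(ℝ, E)) (I' := 𝓘(ℝ, E)) (I'' := 𝓘(ℝ, E))
    (x := (1 : G)) (y := g) (f := fun h : G => g * h)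
    (g := fun h : G => g⁻¹ * h) (mdifferentiableAt_mul_left _ _)
    (mdifferentiableAt_mul_left _ _) (mul_one g) v
  have h2 : ((fun h : G => g⁻¹ * h) ∘ fun h : G => g * h) = id := by ext x; simp
  rw [h2, mfderiv_id] at h1
  exact h1.symm

theorem mulInvariantVectorField_leftTriv (g : G) (X : TangentSpace 𝓘(ℝ, E) g) :
    mulInvariantVectorField (leftTriv g X) g = X := by
  have h1 := mfderiv_comp_apply_of_eq (I := 𝓘(ℝ, E)) (I' := 𝓘(ℝ, E)) (I'' := 𝓘(ℝ, E))
    (x := g) (y := (1 : G)) (f := fun h : G => g⁻¹ * h)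
    (g := fun h : G => g * h) (mdifferentiableAt_mul_left _ _)
    (mdifferentiableAt_mul_left _ _) (inv_mul_cancel g) X
  have h2 : ((fun h : G => g * h) ∘ fun h : G => g⁻¹ * h) = id := by ext x; simp
  rw [h2, mfderiv_id] at h1
  exact h1.symm

/-- The left trivialization of a vector field differentiable at `g` is differentiable at `g`. -/
theorem mdifferentiableAt_leftTriv {Y : Π h : G, TangentSpace 𝓘(ℝ, E) h} {g : G}
    (hY : MDiffAt (T% Y) g) :
    MDiffAt (leftTrivField Y) g := by
  let z : G → TangentBundle 𝓘(ℝ, E) G := fun h => TotalSpace.mk' E h⁻¹ 0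
  have hz : MDiffAt z g := by
    have h0 : ContMDiff 𝓘(ℝ, E) 𝓘(ℝ, E).tangent ∞
        (fun h : G => (TotalSpace.mk' E h 0 : TangentBundle 𝓘(ℝ, E) G)) :=
      contMDiff_zeroSection _ _
    exact ((h0.comp (contMDiff_inv 𝓘(ℝ, E) ∞)).contMDiffAt).mdifferentiableAt (by simp)
  let F₁ : G → TangentBundle 𝓘(ℝ, E) G × TangentBundle 𝓘(ℝ, E) G :=
    fun h => (z h, TotalSpace.mk' E h (Y h))
  have S₁ : MDiffAt F₁ g := hz.prodMk hY
  let F₂ : (TangentBundle 𝓘(ℝ, E) G × TangentBundle 𝓘(ℝ, E) G) →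
      TangentBundle (𝓘(ℝ, E).prod 𝓘(ℝ, E)) (G × G) :=
    (equivTangentBundleProd 𝓘(ℝ, E) G 𝓘(ℝ, E) G).symm
  have S₂ : CMDiff 1 F₂ := contMDiff_equivTangentBundleProd_symm
  let F₃ : TangentBundle (𝓘(ℝ, E).prod 𝓘(ℝ, E)) (G × G) → TangentBundle 𝓘(ℝ, E) G :=
    tangentMap (𝓘(ℝ, E).prod 𝓘(ℝ, E)) 𝓘(ℝ, E) (fun p : G × G => p.1 * p.2)
  have S₃ : CMDiff 1 F₃ :=
    ContMDiff.contMDiff_tangentMap (contMDiff_mul 𝓘(ℝ, E) 2) (m := 1) (by norm_num)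
  have S : MDiffAt (F₃ ∘ F₂ ∘ F₁) g :=
    ((S₃.mdifferentiable (by simp)) _).comp g (((S₂.mdifferentiable (by simp)) _).comp g S₁)
  have key : ∀ h : G, (F₃ ∘ F₂ ∘ F₁) h = TotalSpace.mk' E 1 (leftTriv h (Y h)) := by
    intro h
    have e1 : mfderiv (𝓘(ℝ, E).prod 𝓘(ℝ, E)) 𝓘(ℝ, E) (fun p : G × G => p.1 * p.2) (h⁻¹, h)
        ((0 : E), (Y h : E)) = leftTriv h (Y h) := by
      have e2 := mfderiv_prod_eq_add_apply (I := 𝓘(ℝ, E)) (I' := 𝓘(ℝ, E)) (I'' := 𝓘(ℝ, E))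
        (p := (h⁻¹, h)) (f := fun p : G × G => p.1 * p.2) (v := ((0 : E), (Y h : E)))
        ((contMDiff_mul 𝓘(ℝ, E) ∞).mdifferentiable (by simp) (h⁻¹, h))
      refine e2.trans ?_
      erw [map_zero, zero_add]
      rfl
    have e3 : (F₃ ∘ F₂ ∘ F₁) h = TotalSpace.mk' E (h⁻¹ * h)
        (mfderiv (𝓘(ℝ, E).prod 𝓘(ℝ, E)) 𝓘(ℝ, E) (fun p : G × G => p.1 * p.2) (h⁻¹, h)
          ((0 : E), (Y h : E))) := rfl
    rw [e3, e1]
    have e4 : ∀ (a : G) (w : E), a = 1 →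
        (TotalSpace.mk' E a w : TangentBundle 𝓘(ℝ, E) G) = TotalSpace.mk' E 1 w := by
      rintro a w rfl; rfl
    exact e4 _ _ (inv_mul_cancel h)
  rw [funext key] at S
  have S' := ((mdifferentiableAt_totalSpace _ _).1 S).2
  refine S'.congr_of_eventuallyEq (Filter.Eventually.of_forall fun h => ?_)
  exact ((tangentBundleCore 𝓘(ℝ, E) G).coordChange_self (achart E (1 : G)) 1
    (mem_chart_source E 1) (leftTriv h (Y h))).symm

end

section

variable {E : Type*} [NormedAddCommGroup E] [NormedSpace ℝ E]
  {G : Type*} [TopologicalSpace G] [ChartedSpace E G] [Group G]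

/-- The differential at the unit of left translation by `g`, as a map from the Lie algebra to the
tangent space at `g`; it sends `v` to `mulInvariantVectorField v g`. -/
def leftTrivSymm (g : G) : GroupLieAlgebra 𝓘(ℝ, E) G →L[ℝ] TangentSpace 𝓘(ℝ, E) g :=
  mfderiv 𝓘(ℝ, E) 𝓘(ℝ, E) (fun h : G => g * h) 1

end

section

variable {E : Type*} [NormedAddCommGroup E] [NormedSpace ℝ E] [CompleteSpace E]
  [FiniteDimensional ℝ E]
  {G : Type*} [TopologicalSpace G] [ChartedSpace E G] [Group G] [LieGroup 𝓘(ℝ, E) ∞ G]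

/-- The continuous linear map `x ↦ ⁅x, y⁆` on the Lie algebra. -/
def bracketRight (y : GroupLieAlgebra 𝓘(ℝ, E) G) :
    GroupLieAlgebra 𝓘(ℝ, E) G →L[ℝ] GroupLieAlgebra 𝓘(ℝ, E) G where
  toFun x := ⁅x, y⁆
  map_add' x x' := add_lie x x' y
  map_smul' c x := smul_lie c x y
  cont := by
    let L : GroupLieAlgebra 𝓘(ℝ, E) G →ₗ[ℝ] GroupLieAlgebra 𝓘(ℝ, E) G :=
      { toFun := fun x => ⁅x, y⁆
        map_add' := fun x x' => add_lie x x' y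
        map_smul' := fun c x => smul_lie c x y }
    have hL : ∀ M : E →ₗ[ℝ] E, Continuous M := fun M => M.continuous_of_finiteDimensional
    exact hL L

theorem bracketRight_apply (y x : GroupLieAlgebra 𝓘(ℝ, E) G) : bracketRight y x = ⁅x, y⁆ := rfl

theorem bracketRight_add (y y' : GroupLieAlgebra 𝓘(ℝ, E) G) :
    bracketRight (y + y') = bracketRight y + bracketRight y' := by
  ext x
  exact lie_add x y y'

theorem bracketRight_smul (c : ℝ) (y : GroupLieAlgebra 𝓘(ℝ, E) G) :
    bracketRight (c • y) = c • bracketRight y := by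
  ext x
  exact lie_smul c x y

variable (E G) in
/-- The canonical (torsion-free, biinvariant) Cartan-Schouten connection. In the left
trivialization of the tangent bundle it is `∇_x y = dy (x) + ½ ⁅x, y⁆`, so that
`∇_x y = ½ ⁅x, y⁆` for left invariant vector fields. -/
def connection : CovariantDerivative 𝓘(ℝ, E) E (TangentSpace 𝓘(ℝ, E) : G → Type _) where
  toFun Y g := leftTrivSymm g ∘L
    (leftTrivDeriv Y g +
      (1 / 2 : ℝ) • (bracketRight (leftTriv g (Y g)) ∘L leftTriv g))
  isCovariantDerivativeOnUniv :=
    { add := by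
        intro Y Y' g hY hY' _
        have h1 : leftTrivDeriv (Y + Y') g = leftTrivDeriv Y g + leftTrivDeriv Y' g := by
          have h2 : leftTrivField (Y + Y') = leftTrivField Y + leftTrivField Y' := by
            ext h
            exact map_add (leftTriv h) (Y h) (Y' h)
          unfold leftTrivDeriv
          rw [h2]
          exact mvfderiv_add (mdifferentiableAt_leftTriv hY) (mdifferentiableAt_leftTriv hY')
        rw [h1, Pi.add_apply, map_add, bracketRight_add]
        ext X
        simp
        module
      leibniz := by
        intro Y f g hY hf _
        have h1 : leftTrivDeriv (f • Y) g = f g • leftTrivDeriv Y g +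
            (mvfderiv 𝓘(ℝ, E) f g).smulRight (leftTriv g (Y g)) := by
          have h2 : leftTrivField (f • Y) = f • leftTrivField Y := by
            ext h
            exact map_smul (leftTriv h) (f h) (Y h)
          unfold leftTrivDeriv
          rw [h2]
          exact mvfderiv_smul hf (mdifferentiableAt_leftTriv hY)
        have h3 : leftTrivSymm g (leftTriv g (Y g)) = Y g :=
          mulInvariantVectorField_leftTriv g (Y g)
        rw [h1, Pi.smul_apply', map_smul, bracketRight_smul]
        ext X
        simp [h3]
        module }

/-- The connection is given by half the Lie bracket on left invariant vector fields. -/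
theorem connection_mulInvariantVectorField (x y : GroupLieAlgebra 𝓘(ℝ, E) G) (g : G) :
    connection E G (mulInvariantVectorField y) g (mulInvariantVectorField x g) =
      (1 / 2 : ℝ) • mulInvariantVectorField ⁅x, y⁆ g := by
  have h1 : leftTrivDeriv (mulInvariantVectorField y) g = 0 := by
    have h2 : leftTrivField (mulInvariantVectorField y) = fun _ => (y : E) := by
      ext h
      exact leftTriv_mulInvariantVectorField h y
    unfold leftTrivDeriv
    rw [h2]
    exact mvfderiv_const _
  have h3 : connection E G (mulInvariantVectorField y) g = leftTrivSymm g ∘L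
      (leftTrivDeriv (mulInvariantVectorField y) g +
        (1 / 2 : ℝ) • (bracketRight (leftTriv g (mulInvariantVectorField y g)) ∘L leftTriv g)) :=
    rfl
  rw [h3, h1, leftTriv_mulInvariantVectorField]
  simp [leftTriv_mulInvariantVectorField, bracketRight_apply]
  rfl

/-- A (smooth, Riemannian or pseudo-Riemannian) metric on `G`: a smooth field of symmetric
nondegenerate bilinear forms on the tangent spaces. -/
structure Metric (E : Type*) [NormedAddCommGroup E] [NormedSpace ℝ E]
    (G : Type*) [TopologicalSpace G] [ChartedSpace E G] [IsManifold 𝓘(ℝ, E) 1 G] where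
  /-- The bilinear form on the tangent space at a point. -/
  form (g : G) : TangentSpace 𝓘(ℝ, E) g →L[ℝ] TangentSpace 𝓘(ℝ, E) g →L[ℝ] ℝ
  symm (g : G) (v w : TangentSpace 𝓘(ℝ, E) g) : form g v w = form g w v
  nondegenerate (g : G) (v : TangentSpace 𝓘(ℝ, E) g) : (∀ w, form g v w = 0) → v = 0
  contMDiff : ContMDiff 𝓘(ℝ, E) (𝓘(ℝ, E).prod 𝓘(ℝ, E →L[ℝ] E →L[ℝ] ℝ)) ∞
    (fun g ↦ TotalSpace.mk' (E →L[ℝ] E →L[ℝ] ℝ)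
      (E := fun g : G ↦ TangentSpace 𝓘(ℝ, E) g →L[ℝ] TangentSpace 𝓘(ℝ, E) g →L[ℝ] ℝ) g (form g))

/-- `μ` is a Cartan-Schouten metric: it is parallel for the canonical Cartan-Schouten connection,
that is `X·μ(Y, Z) = μ(∇_X Y, Z) + μ(Y, ∇_X Z)` for all vector fields. -/
def Metric.IsCartanSchouten (μ : Metric E G) : Prop :=
  ∀ (Y Z : Π h : G, TangentSpace 𝓘(ℝ, E) h) (g : G), MDiffAt (T% Y) g → MDiffAt (T% Z) g →
    ∀ X : TangentSpace 𝓘(ℝ, E) g,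
      mvfderiv 𝓘(ℝ, E) (fun h => μ.form h (Y h) (Z h)) g X =
        μ.form g (connection E G Y g X) (Z g) + μ.form g (Y g) (connection E G Z g X)

/-- The metric is positive definite (Riemannian). -/
def Metric.IsPositiveDefinite (μ : Metric E G) : Prop :=
  ∀ (g : G) (v : TangentSpace 𝓘(ℝ, E) g), v ≠ 0 → 0 < μ.form g v v

/-- The metric is negative definite. -/
def Metric.IsNegativeDefinite (μ : Metric E G) : Prop :=
  ∀ (g : G) (v : TangentSpace 𝓘(ℝ, E) g), v ≠ 0 → μ.form g v v < 0

end

/-- A Lie algebra is 2-step nilpotent if it is not abelian and its derived ideal is contained in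
its center. -/
def IsTwoStepNilpotent (L : Type*) [LieRing L] [LieAlgebra ℝ L] : Prop :=
  ¬ IsLieAbelian L ∧ ⁅(⊤ : LieIdeal ℝ L), (⊤ : LieIdeal ℝ L)⁆ ≤ LieAlgebra.center ℝ L

end CartanSchouten

end

/-! Write θ for the left Maurer-Cartan form.

Definite implies 2-step: for a parallel metric μ, the derivative of μ(u⁺, v⁺) along x⁺ is
½(μ([x,u]⁺, v⁺) + μ(u⁺, [x,v]⁺)). Differentiating twice and comparing with the derivative along
[x,y]⁺ shows that every ad [x,y] is skew for μ at the unit; this is the skewness of the curvature,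
which is a multiple of ad [x,y] (`Metric.IsCartanSchouten.skew`). If μ is definite, a skew operator
whose square kills a vector already kills that vector. Climbing back up the derived series from 0,
this forces each derived ideal, finally [L, L], into the center (`derived_le_center_of_skew`).

2-step implies definite: set N = 1 - Ad(g⁻¹) on the identity component. Since N takes central values
and kills the center, N² = 0, so Ad(g) = 1 + N has the square root S(g) = 1 + N/2. Its derivative
along X is ½ ad(θ(X)), and S fixes all brackets, hence d(S θ(Y))(X) = S θ(∇_X Y)
(`mvfderiv_componentSqrtAd_leftTrivField`). Thus Sθ is a parallel trivialization of the tangent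
bundle, and the pullback of any constant inner product, of either sign, is a Cartan-Schouten metric.
Left translations preserve ∇ and θ, which carries the construction to the other components. -/

noncomputable section

namespace CartanSchouten

/-! ### Definite forms and the derived series -/

/-- If every `ad ⁅x, y⁆` is skew-symmetric for a definite form on a solvable Lie algebra, then all
the `ad ⁅x, y⁆` vanish. -/
theorem derived_le_center_of_skew {L : Type*} [LieRing L] [LieAlgebra ℝ L]
    [LieAlgebra.IsSolvable L] (B : L →ₗ[ℝ] L →ₗ[ℝ] ℝ)
    (hdef : ∀ v, v ≠ 0 → 0 < B v v)
    (hskew : ∀ x y u v : L, B ⁅⁅x, y⁆, u⁆ v + B u ⁅⁅x, y⁆, v⁆ = 0) :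
    ⁅(⊤ : LieIdeal ℝ L), (⊤ : LieIdeal ℝ L)⁆ ≤ LieAlgebra.center ℝ L := by
  have hdef' : ∀ v, B v v = 0 → v = 0 := fun v hv => by
    by_contra h
    exact (hdef v h).ne' hv
  have hskew' : ∀ w ∈ ⁅(⊤ : LieIdeal ℝ L), (⊤ : LieIdeal ℝ L)⁆, ∀ u v : L,
      B ⁅w, u⁆ v + B u ⁅w, v⁆ = 0 := by
    intro w hw u v
    rw [← LieSubmodule.mem_toSubmodule, LieSubmodule.lieIdeal_oper_eq_linear_span'] at hw
    induction hw using Submodule.span_induction with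
    | mem w hw =>
      obtain ⟨x, -, y, -, rfl⟩ := hw
      exact hskew x y u v
    | zero => simp
    | add w w' _ _ h h' =>
      simp only [add_lie, map_add, LinearMap.add_apply]
      linarith
    | smul c w _ h =>
      simp only [smul_lie, map_smul, LinearMap.smul_apply, smul_eq_mul]
      linear_combination c * h
  -- By skewness B([w,u], [w,u]) = -B(u, [w,[w,u]]), so definiteness makes the kernels of (ad w)²
  -- and ad w coincide.
  have hsq : ∀ w ∈ ⁅(⊤ : LieIdeal ℝ L), (⊤ : LieIdeal ℝ L)⁆, ∀ u : L,
      ⁅w, ⁅w, u⁆⁆ = 0 → ⁅w, u⁆ = 0 := by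
    intro w hw u h
    apply hdef'
    have h1 := hskew' w hw u ⁅w, u⁆
    rwa [h, map_zero, add_zero] at h1
  have hcentral : ∀ z : L, (∀ u : L, ⁅z, u⁆ = 0) → z ∈ LieAlgebra.center ℝ L := by
    intro z hz
    rw [LieModule.mem_maxTrivSubmodule]
    intro u
    rw [← lie_skew, hz u, neg_zero]
  obtain ⟨n, hn⟩ := (LieAlgebra.isSolvable_iff ℝ L).1 inferInstance
  have hle : ∀ k, LieAlgebra.derivedSeries ℝ L (k + 1) ≤
      ⁅(⊤ : LieIdeal ℝ L), (⊤ : LieIdeal ℝ L)⁆ := fun k => by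
    have := LieAlgebra.derivedSeriesOfIdeal_antitone (R := ℝ) (L := L) ⊤ (Nat.le_add_left 1 k)
    simpa [LieAlgebra.derivedSeries_def] using this
  -- Centrality climbs the series. For w in the term D below, [w, D] lies in the next, central,
  -- term, so `hsq` gives [w, D] = 0. As D is an ideal, [w, u] lies in D for every u, and `hsq`
  -- applies again.
  have key : ∀ k, LieAlgebra.derivedSeries ℝ L (k + 1) ≤ LieAlgebra.center ℝ L →
      LieAlgebra.derivedSeries ℝ L 1 ≤ LieAlgebra.center ℝ L := by
    intro k
    induction k with
    | zero => exact fun h => h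
    | succ k ih =>
      intro h
      apply ih
      intro w hw
      apply hcentral
      have h1 : ∀ a ∈ LieAlgebra.derivedSeries ℝ L (k + 1), ⁅w, a⁆ = 0 := by
        intro a ha
        apply hsq w (hle k hw) a
        have h2 : ⁅w, a⁆ ∈ LieAlgebra.derivedSeries ℝ L (k + 1 + 1) := by
          rw [LieAlgebra.derivedSeries_def, LieAlgebra.derivedSeriesOfIdeal_succ]
          exact LieSubmodule.lie_mem_lie hw ha
        exact (LieModule.mem_maxTrivSubmodule _ _ _ _).1 (h h2) w
      intro u
      apply hsq w (hle k hw) u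
      apply h1
      rw [← lie_skew]
      exact neg_mem (lie_mem_right ℝ L _ u w hw)
  -- The index is one past the solvability length because `key` only treats terms of index at least
  -- 1, those inside [L, L].
  have hlast : LieAlgebra.derivedSeries ℝ L (n + 1) ≤ LieAlgebra.center ℝ L := by
    rw [LieAlgebra.derivedSeries_def, LieAlgebra.derivedSeriesOfIdeal_succ,
      ← LieAlgebra.derivedSeries_def, hn]
    simp
  simpa [LieAlgebra.derivedSeries_def] using key n hlast

/-! ### Left invariant fields and their bracket in the chart at the unit -/

section

variable {E : Type*} [NormedAddCommGroup E] [NormedSpace ℝ E]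
  {G : Type*} [TopologicalSpace G] [ChartedSpace E G] [Group G]

/-- A vector field read in the chart at the unit. -/
def chartField (V : Π g : G, TangentSpace 𝓘(ℝ, E) g) (a : E) : E :=
  mfderiv 𝓘(ℝ, E) 𝓘(ℝ, E) (extChartAt 𝓘(ℝ, E) (1 : G)) ((extChartAt 𝓘(ℝ, E) (1 : G)).symm a)
    (V ((extChartAt 𝓘(ℝ, E) (1 : G)).symm a))

theorem mulInvariantVectorField_unit (x : GroupLieAlgebra 𝓘(ℝ, E) G) :
    mulInvariantVectorField x 1 = x := by
  have h : (fun h : G => 1 * h) = id := by ext; simp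
  unfold mulInvariantVectorField
  rw [h, mfderiv_id]
  rfl

variable [LieGroup 𝓘(ℝ, E) ∞ G]

theorem chartField_unit (V : Π g : G, TangentSpace 𝓘(ℝ, E) g) :
    chartField V (extChartAt 𝓘(ℝ, E) (1 : G) 1) = V 1 := by
  unfold chartField
  rw [extChartAt_to_inv, mfderiv_extChartAt_self]
  rfl

theorem chartField_mulInvariantVectorField_unit (x : GroupLieAlgebra 𝓘(ℝ, E) G) :
    chartField (mulInvariantVectorField x) (extChartAt 𝓘(ℝ, E) (1 : G) 1) = x :=
  (chartField_unit _).trans (mulInvariantVectorField_unit x)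

/-- The manifold bracket is defined by pulling back to the chart, where it is DY(X) - DX(Y). At the
unit the chart's differential is the identity, so no conjugation remains. -/
theorem lie_eq_fderiv_chartField (x y : GroupLieAlgebra 𝓘(ℝ, E) G) :
    (⁅x, y⁆ : GroupLieAlgebra 𝓘(ℝ, E) G) =
      fderiv ℝ (chartField (mulInvariantVectorField y)) (extChartAt 𝓘(ℝ, E) (1 : G) 1) (x : E) -
      fderiv ℝ (chartField (mulInvariantVectorField x)) (extChartAt 𝓘(ℝ, E) (1 : G) 1) (y : E) := by
  have h : ∀ V : Π g : G, TangentSpace 𝓘(ℝ, E) g,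
      VectorField.mpullbackWithin 𝓘(ℝ, E) 𝓘(ℝ, E) (extChartAt 𝓘(ℝ, E) (1 : G)).symm V
        (Set.range 𝓘(ℝ, E)) =ᶠ[nhds (extChartAt 𝓘(ℝ, E) (1 : G) 1)] chartField V := by
    intro V
    filter_upwards [extChartAt_target_mem_nhds (I := 𝓘(ℝ, E)) (1 : G)] with a ha
    have h1 := ContinuousLinearMap.inverse_eq
      (mfderivWithin_extChartAt_symm_comp_mfderiv_extChartAt (I := 𝓘(ℝ, E)) ha)
      (mfderiv_extChartAt_comp_mfderivWithin_extChartAt_symm (I := 𝓘(ℝ, E)) ha)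
    rw [VectorField.mpullbackWithin_apply, h1]
    rfl
  have h2 : ∀ A B : E → E, VectorField.lieBracketWithin ℝ A B
      ((extChartAt 𝓘(ℝ, E) (1 : G)).symm ⁻¹' Set.univ ∩ Set.range 𝓘(ℝ, E))
        (extChartAt 𝓘(ℝ, E) (1 : G) 1) =
      fderiv ℝ B (extChartAt 𝓘(ℝ, E) (1 : G) 1) (A (extChartAt 𝓘(ℝ, E) (1 : G) 1)) -
      fderiv ℝ A (extChartAt 𝓘(ℝ, E) (1 : G) 1) (B (extChartAt 𝓘(ℝ, E) (1 : G) 1)) := by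
    intro A B
    simp [VectorField.lieBracketWithin]
  have h3 : ∀ w : E, (mfderiv 𝓘(ℝ, E) 𝓘(ℝ, E) (extChartAt 𝓘(ℝ, E) (1 : G)) 1).inverse w = w := by
    intro w
    rw [mfderiv_extChartAt_self]
    exact congrArg (fun T : E →L[ℝ] E => T w) ContinuousLinearMap.inverse_id
  rw [GroupLieAlgebra.bracket_def, ← VectorField.mlieBracketWithin_univ,
    VectorField.mlieBracketWithin_apply]
  refine (h3 _).trans ((h2 _ _).trans ?_)
  refine congrArg₂ (fun u v : E => u - v) ?_ ?_
  · exact congrArg₂ (fun (T : E →L[ℝ] E) w => T w) (h _).fderiv_eq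
      ((h _).eq_of_nhds.trans (chartField_mulInvariantVectorField_unit x))
  · exact congrArg₂ (fun (T : E →L[ℝ] E) w => T w) (h _).fderiv_eq
      ((h _).eq_of_nhds.trans (chartField_mulInvariantVectorField_unit y))

end

/-! ### Multiplication in the chart, and the bracket as a commutator -/

section

variable {E : Type*} [NormedAddCommGroup E] [NormedSpace ℝ E]
  {G : Type*} [TopologicalSpace G] [ChartedSpace E G] [Group G]

variable (G) in
/-- The multiplication of `G` read in the chart at the unit. -/
def chartMul (p : E × E) : E :=
  extChartAt 𝓘(ℝ, E) (1 : G)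
    ((extChartAt 𝓘(ℝ, E) (1 : G)).symm p.1 * (extChartAt 𝓘(ℝ, E) (1 : G)).symm p.2)

theorem eventually_mem_chart :
    ∀ᶠ a in nhds (extChartAt 𝓘(ℝ, E) (1 : G) 1),
      (extChartAt 𝓘(ℝ, E) (1 : G)).symm a ∈ (extChartAt 𝓘(ℝ, E) (1 : G)).source ∧
      extChartAt 𝓘(ℝ, E) (1 : G) ((extChartAt 𝓘(ℝ, E) (1 : G)).symm a) = a := by
  filter_upwards [extChartAt_target_mem_nhds (I := 𝓘(ℝ, E)) (1 : G)] with a ha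
  exact ⟨PartialEquiv.map_target _ ha, PartialEquiv.right_inv _ ha⟩

variable [LieGroup 𝓘(ℝ, E) ∞ G]

theorem two_le_infty : (2 : WithTop ℕ∞) ≤ ∞ := by
  exact ENat.LEInfty.out

theorem contMDiffAt_extChartAt_unit_symm :
    ContMDiffAt 𝓘(ℝ, E) 𝓘(ℝ, E) ∞ (extChartAt 𝓘(ℝ, E) (1 : G)).symm
      (extChartAt 𝓘(ℝ, E) (1 : G) 1) :=
  (contMDiffOn_extChartAt_symm (1 : G)).contMDiffAt (extChartAt_target_mem_nhds (1 : G))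

theorem contDiffAt_chartMul :
    ContDiffAt ℝ ∞ (chartMul G)
      ((extChartAt 𝓘(ℝ, E) (1 : G) 1, extChartAt 𝓘(ℝ, E) (1 : G) 1) : E × E) := by
  rw [← contMDiffAt_iff_contDiffAt]
  have h1 : ContMDiffAt 𝓘(ℝ, E × E) 𝓘(ℝ, E) ∞
      (fun p : E × E => (extChartAt 𝓘(ℝ, E) (1 : G)).symm p.1)
      ((extChartAt 𝓘(ℝ, E) (1 : G) 1, extChartAt 𝓘(ℝ, E) (1 : G) 1) : E × E) :=
    ContMDiffAt.comp _ contMDiffAt_extChartAt_unit_symm contDiff_fst.contMDiff.contMDiffAt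
  have h2 : ContMDiffAt 𝓘(ℝ, E × E) 𝓘(ℝ, E) ∞
      (fun p : E × E => (extChartAt 𝓘(ℝ, E) (1 : G)).symm p.2)
      ((extChartAt 𝓘(ℝ, E) (1 : G) 1, extChartAt 𝓘(ℝ, E) (1 : G) 1) : E × E) :=
    ContMDiffAt.comp _ contMDiffAt_extChartAt_unit_symm contDiff_snd.contMDiff.contMDiffAt
  refine ContMDiffAt.comp_of_eq (y := (1 : G))
    (contMDiffAt_extChartAt (I := 𝓘(ℝ, E)) (n := ∞) (x := (1 : G))) (h1.mul h2) ?_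
  simp

/-- Needed at all points near the unit with one fixed chart, since the derivative will itself be
differentiated. -/
theorem mvfderiv_eq_fderiv_chart {F : Type*} [NormedAddCommGroup F] [NormedSpace ℝ F] {f : G → F}
    {g : G} (hg : g ∈ (extChartAt 𝓘(ℝ, E) (1 : G)).source) (hf : MDiffAt f g)
    (v : TangentSpace 𝓘(ℝ, E) g) :
    mvfderiv 𝓘(ℝ, E) f g v =
      fderiv ℝ (f ∘ (extChartAt 𝓘(ℝ, E) (1 : G)).symm) (extChartAt 𝓘(ℝ, E) (1 : G) g)
        (mfderiv 𝓘(ℝ, E) 𝓘(ℝ, E) (extChartAt 𝓘(ℝ, E) (1 : G)) g v) := by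
  set e := extChartAt 𝓘(ℝ, E) (1 : G) with he
  have h1 : f =ᶠ[nhds g] (f ∘ e.symm) ∘ e := by
    filter_upwards [extChartAt_source_mem_nhds' (I := 𝓘(ℝ, E)) hg] with h hh
    simp [e.left_inv hh]
  have h2 : MDifferentiableAt 𝓘(ℝ, E) 𝓘(ℝ, E) e g :=
    mdifferentiableAt_extChartAt (by simpa [he] using hg)
  have h3 : MDifferentiableAt 𝓘(ℝ, E) 𝓘(ℝ, E) e.symm (e g) := by
    have := mdifferentiableWithinAt_extChartAt_symm (I := 𝓘(ℝ, E)) (x := (1 : G))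
      ((extChartAt 𝓘(ℝ, E) (1 : G)).map_source hg)
    rwa [show Set.range 𝓘(ℝ, E) = Set.univ by simp, mdifferentiableWithinAt_univ] at this
  have h4 : MDifferentiableAt 𝓘(ℝ, E) 𝓘(ℝ, F) (f ∘ e.symm) (e g) :=
    MDifferentiableAt.comp_of_eq _ (y := g) hf h3 (e.left_inv hg)
  have h5 : mfderiv 𝓘(ℝ, E) 𝓘(ℝ, F) f g v = mfderiv 𝓘(ℝ, E) 𝓘(ℝ, F) (f ∘ e.symm) (e g)
      (mfderiv 𝓘(ℝ, E) 𝓘(ℝ, E) e g v) := by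
    rw [h1.mfderiv_eq]
    exact mfderiv_comp_apply g h4 h2 v
  rw [mfderiv_eq_fderiv] at h5
  exact h5

theorem mvfderiv_unit_eq_fderiv_chart {F : Type*} [NormedAddCommGroup F] [NormedSpace ℝ F]
    {f : G → F} (hf : MDiffAt f (1 : G)) (v : GroupLieAlgebra 𝓘(ℝ, E) G) :
    mvfderiv 𝓘(ℝ, E) f (1 : G) v =
      fderiv ℝ (f ∘ (extChartAt 𝓘(ℝ, E) (1 : G)).symm) (extChartAt 𝓘(ℝ, E) (1 : G) 1) (v : E) := by
  rw [mvfderiv_eq_fderiv_chart (mem_extChartAt_source _) hf, mfderiv_extChartAt_self]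
  rfl

theorem mdifferentiableAt_mul_right (a b : G) :
    MDifferentiableAt 𝓘(ℝ, E) 𝓘(ℝ, E) (fun h : G => h * a) b :=
  (contMDiff_mul_right (I := 𝓘(ℝ, E)) (n := ∞)).contMDiffAt.mdifferentiableAt (by simp)

/-- A left invariant field is the partial derivative of the multiplication in its second variable,
which reduces its first-order behaviour to second derivatives of `chartMul`. -/
theorem mfderiv_chart_mul_left {a : E}
    (ha : (extChartAt 𝓘(ℝ, E) (1 : G)).symm a ∈ (extChartAt 𝓘(ℝ, E) (1 : G)).source)
    (ha' : DifferentiableAt ℝ (chartMul G) (a, extChartAt 𝓘(ℝ, E) (1 : G) 1))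
    (y : E) :
    chartField (mulInvariantVectorField (G := G) y) a =
      fderiv ℝ (chartMul G) (a, extChartAt 𝓘(ℝ, E) (1 : G) 1) ((0 : E), (y : E)) := by
  set e := extChartAt 𝓘(ℝ, E) (1 : G) with he
  have h2 : MDifferentiableAt 𝓘(ℝ, E) 𝓘(ℝ, E) e (e.symm a) :=
    mdifferentiableAt_extChartAt (by simpa [he] using ha)
  have h3 := mdifferentiableAt_mul_left (E := E) (e.symm a) (1 : G)
  have h1 := mfderiv_comp_apply_of_eq (I := 𝓘(ℝ, E)) (I' := 𝓘(ℝ, E)) (I'' := 𝓘(ℝ, E))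
    (x := (1 : G)) (y := e.symm a) (f := fun h : G => e.symm a * h) (g := e) h2 h3
    (mul_one _) y
  have h4 := mvfderiv_unit_eq_fderiv_chart (f := e ∘ fun h : G => e.symm a * h)
    (MDifferentiableAt.comp_of_eq _ (y := e.symm a) h2 h3 (mul_one _)) y
  have h5 : HasFDerivAt ((e ∘ fun h : G => e.symm a * h) ∘ e.symm)
      ((fderiv ℝ (chartMul G) (a, e 1)) ∘L (ContinuousLinearMap.inr ℝ E E)) (e 1) :=
    ha'.hasFDerivAt.comp (e 1) (hasFDerivAt_prodMk_right a (e 1))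
  rw [← he, h5.fderiv] at h4
  exact h1.symm.trans h4

theorem mfderiv_chart_mul_right {a : E}
    (ha : (extChartAt 𝓘(ℝ, E) (1 : G)).symm a ∈ (extChartAt 𝓘(ℝ, E) (1 : G)).source)
    (ha' : DifferentiableAt ℝ (chartMul G) (extChartAt 𝓘(ℝ, E) (1 : G) 1, a))
    (y : E) :
    chartField (fun g => (mfderiv 𝓘(ℝ, E) 𝓘(ℝ, E) (fun h : G => h * g) 1 y : E)) a =
      fderiv ℝ (chartMul G) (extChartAt 𝓘(ℝ, E) (1 : G) 1, a) ((y : E), (0 : E)) := by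
  set e := extChartAt 𝓘(ℝ, E) (1 : G) with he
  have h2 : MDifferentiableAt 𝓘(ℝ, E) 𝓘(ℝ, E) e (e.symm a) :=
    mdifferentiableAt_extChartAt (by simpa [he] using ha)
  have h3 := mdifferentiableAt_mul_right (E := E) (e.symm a) (1 : G)
  have h1 := mfderiv_comp_apply_of_eq (I := 𝓘(ℝ, E)) (I' := 𝓘(ℝ, E)) (I'' := 𝓘(ℝ, E))
    (x := (1 : G)) (y := e.symm a) (f := fun h : G => h * e.symm a) (g := e) h2 h3
    (one_mul _) y
  have h4 := mvfderiv_unit_eq_fderiv_chart (f := e ∘ fun h : G => h * e.symm a)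
    (MDifferentiableAt.comp_of_eq _ (y := e.symm a) h2 h3 (one_mul _)) y
  have h5 : HasFDerivAt ((e ∘ fun h : G => h * e.symm a) ∘ e.symm)
      ((fderiv ℝ (chartMul G) (e 1, a)) ∘L (ContinuousLinearMap.inl ℝ E E)) (e 1) :=
    ha'.hasFDerivAt.comp (e 1) (f := fun b : E => (b, a)) (g := chartMul G)
      (hasFDerivAt_prodMk_left (e 1) a)
  rw [← he, h5.fderiv] at h4
  exact h1.symm.trans h4

theorem eventually_differentiableAt_chartMul :
    ∀ᶠ p in nhds ((extChartAt 𝓘(ℝ, E) (1 : G) 1, extChartAt 𝓘(ℝ, E) (1 : G) 1) : E × E),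
      DifferentiableAt ℝ (chartMul G) p :=
  ((contDiffAt_chartMul.of_le (m := 1) (by simp)).eventually (by simp)).mono
    fun _ h => h.differentiableAt (by simp)

theorem differentiableAt_fderiv_chartMul :
    DifferentiableAt ℝ (fderiv ℝ (chartMul G))
      ((extChartAt 𝓘(ℝ, E) (1 : G) 1, extChartAt 𝓘(ℝ, E) (1 : G) 1) : E × E) :=
  (contDiffAt_chartMul.fderiv_right (m := 1) (n := ∞) (by simpa [one_add_one_eq_two] using two_le_infty)).differentiableAt (by simp)

theorem hasFDerivAt_chartField_mulInvariantVectorField (y : E) :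
    HasFDerivAt (chartField (mulInvariantVectorField (G := G) y))
      ((ContinuousLinearMap.apply ℝ E ((0 : E), (y : E))) ∘L
        (fderiv ℝ (fderiv ℝ (chartMul G))
          (extChartAt 𝓘(ℝ, E) (1 : G) 1, extChartAt 𝓘(ℝ, E) (1 : G) 1)) ∘L
        (ContinuousLinearMap.inl ℝ E E)) (extChartAt 𝓘(ℝ, E) (1 : G) 1) := by
  set e := extChartAt 𝓘(ℝ, E) (1 : G) with he
  have h1 : HasFDerivAt (fun a : E => fderiv ℝ (chartMul G) (a, e 1) ((0 : E), (y : E)))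
      ((ContinuousLinearMap.apply ℝ E ((0 : E), (y : E))) ∘L
        (fderiv ℝ (fderiv ℝ (chartMul G)) (e 1, e 1)) ∘L (ContinuousLinearMap.inl ℝ E E)) (e 1) :=
    (ContinuousLinearMap.apply ℝ E ((0 : E), (y : E))).hasFDerivAt.comp (e 1)
      (differentiableAt_fderiv_chartMul.hasFDerivAt.comp (e 1) (hasFDerivAt_prodMk_left (e 1) (e 1)))
  refine h1.congr_of_eventuallyEq ?_
  have h2 : ∀ᶠ a in nhds (e 1), DifferentiableAt ℝ (chartMul G) (a, e 1) :=
    (Continuous.prodMk_left (e 1)).continuousAt.eventually eventually_differentiableAt_chartMul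
  filter_upwards [h2, eventually_mem_chart] with a ha ha'
  exact mfderiv_chart_mul_left ha'.1 ha y

/-- The bracket is the antisymmetrized mixed second derivative of the multiplication. This form is
what the derivative of the adjoint action is compared with. -/
theorem lie_eq_fderiv_fderiv_chartMul (x y : GroupLieAlgebra 𝓘(ℝ, E) G) :
    (⁅x, y⁆ : GroupLieAlgebra 𝓘(ℝ, E) G) =
      fderiv ℝ (fderiv ℝ (chartMul G))
        (extChartAt 𝓘(ℝ, E) (1 : G) 1, extChartAt 𝓘(ℝ, E) (1 : G) 1)
        (@Prod.mk E E x 0) (@Prod.mk E E 0 y) -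
      fderiv ℝ (fderiv ℝ (chartMul G))
        (extChartAt 𝓘(ℝ, E) (1 : G) 1, extChartAt 𝓘(ℝ, E) (1 : G) 1)
        (@Prod.mk E E y 0) (@Prod.mk E E 0 x) := by
  refine (lie_eq_fderiv_chartField x y).trans (congrArg₂ (fun u v : E => u - v) ?_ ?_)
  · exact congrArg (fun T : E →L[ℝ] E => T x)
      (hasFDerivAt_chartField_mulInvariantVectorField (E := E) (G := G) y).fderiv
  · exact congrArg (fun T : E →L[ℝ] E => T y)
      (hasFDerivAt_chartField_mulInvariantVectorField (E := E) (G := G) x).fderiv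

/-- The Lie bracket of left invariant vector fields acts on functions as the commutator of the
derivations. -/
theorem mvfderiv_lie {f : G → ℝ} (hf : ContMDiff 𝓘(ℝ, E) 𝓘(ℝ, ℝ) 2 f)
    (x y : GroupLieAlgebra 𝓘(ℝ, E) G)
    (hx : MDiffAt (fun g : G => mvfderiv 𝓘(ℝ, E) f g (mulInvariantVectorField x g)) (1 : G))
    (hy : MDiffAt (fun g : G => mvfderiv 𝓘(ℝ, E) f g (mulInvariantVectorField y g)) (1 : G)) :
    mvfderiv 𝓘(ℝ, E) f (1 : G) ⁅x, y⁆ =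
      mvfderiv 𝓘(ℝ, E) (fun g => mvfderiv 𝓘(ℝ, E) f g (mulInvariantVectorField y g)) (1 : G) x -
      mvfderiv 𝓘(ℝ, E) (fun g => mvfderiv 𝓘(ℝ, E) f g (mulInvariantVectorField x g)) (1 : G) y := by
  have hfd : MDifferentiable 𝓘(ℝ, E) 𝓘(ℝ, ℝ) f := hf.mdifferentiable (by simp)
  rw [mvfderiv_unit_eq_fderiv_chart hx, mvfderiv_unit_eq_fderiv_chart hy,
    mvfderiv_unit_eq_fderiv_chart (hfd 1), lie_eq_fderiv_chartField]
  set e := extChartAt 𝓘(ℝ, E) (1 : G) with he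
  have hf' : ContDiffAt ℝ 2 (f ∘ e.symm) (e 1) := by
    rw [← contMDiffAt_iff_contDiffAt]
    exact hf.contMDiffAt.comp (e 1)
      (contMDiffAt_extChartAt_unit_symm.of_le two_le_infty)
  have hf2 : DifferentiableAt ℝ (fderiv ℝ (f ∘ e.symm)) (e 1) :=
    (hf'.fderiv_right (m := 1) (by norm_num)).differentiableAt (by simp)
  -- Symmetry of D²f cancels the second-order terms of the commutator, leaving Df applied to the
  -- bracket.
  have hsymm := (hf'.isSymmSndFDerivAt (by simp)).eq
  have h1 : ∀ z w : E,
      fderiv ℝ ((fun g => mvfderiv 𝓘(ℝ, E) f g (mulInvariantVectorField (G := G) z g)) ∘ e.symm) (e 1)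
        (w : E) =
      fderiv ℝ (fderiv ℝ (f ∘ e.symm)) (e 1) (w : E) (z : E) +
      fderiv ℝ (f ∘ e.symm) (e 1) (fderiv ℝ (chartField (mulInvariantVectorField (G := G) z)) (e 1) (w : E)) := by
    intro z w
    have h2 : (fun g => mvfderiv 𝓘(ℝ, E) f g (mulInvariantVectorField (G := G) z g)) ∘ e.symm =ᶠ[nhds (e 1)]
        fun a => fderiv ℝ (f ∘ e.symm) a (chartField (mulInvariantVectorField (G := G) z) a) := by
      filter_upwards [eventually_mem_chart] with a ha
      have h3 := mvfderiv_eq_fderiv_chart ha.1 (hfd _) (mulInvariantVectorField (G := G) z (e.symm a))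
      rw [ha.2] at h3
      exact h3
    have h4 := hf2.hasFDerivAt.clm_apply
      (hasFDerivAt_chartField_mulInvariantVectorField (G := G) z).differentiableAt.hasFDerivAt
    rw [h2.fderiv_eq, h4.fderiv]
    have h5 := chartField_mulInvariantVectorField_unit (G := G) z
    rw [← he] at h5
    simp only [add_apply, ContinuousLinearMap.comp_apply,
      ContinuousLinearMap.flip_apply]
    rw [h5]
    exact add_comm _ _
  have h6 : ∀ p q r s : ℝ, p = q → r - s = (p + r) - (q + s) := by
    rintro p q r s rfl
    ring
  refine (map_sub _ _ _).trans (Eq.trans ?_ (congrArg₂ (fun u v : ℝ => u - v) (h1 y x) (h1 x y)).symm)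
  exact h6 _ _ _ _ (hsymm x y)

end

/-! ### Parallel metrics and the skewness of the curvature -/

section

variable {E : Type*} [NormedAddCommGroup E] [NormedSpace ℝ E]
  {G : Type*} [TopologicalSpace G] [ChartedSpace E G] [Group G] [LieGroup 𝓘(ℝ, E) ∞ G]

theorem contMDiff_mulInvariantVectorField_two (v : GroupLieAlgebra 𝓘(ℝ, E) G) :
    ContMDiff 𝓘(ℝ, E) 𝓘(ℝ, E).tangent 2
      (fun g : G => (TotalSpace.mk' E g (mulInvariantVectorField v g) : TangentBundle 𝓘(ℝ, E) G)) := by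
  exact (contMDiff_mulInvariantVectorField (𝕜 := ℝ) (I := 𝓘(ℝ, E)) (G := G) v).of_le
    (by simp only [minSmoothness_of_isRCLikeNormedField, le_refl])

end

section

variable {E : Type*} [NormedAddCommGroup E] [NormedSpace ℝ E]
  {G : Type*} [TopologicalSpace G] [ChartedSpace E G]

theorem mvfderiv_const_smul_apply {F : Type*} [NormedAddCommGroup F] [NormedSpace ℝ F] (c : ℝ)
    {f : G → F} {g : G} (hf : MDiffAt f g) (v : TangentSpace 𝓘(ℝ, E) g) :
    mvfderiv 𝓘(ℝ, E) (fun h => c • f h) g v = c • mvfderiv 𝓘(ℝ, E) f g v := by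
  have h := mvfderiv_smul (I := 𝓘(ℝ, E)) (x := g) (a := fun _ => c) mdifferentiableAt_const hf
  rw [mvfderiv_const] at h
  refine (congrArg (fun T => T v) h).trans ?_
  simp

end

section

variable {E : Type*} [NormedAddCommGroup E] [NormedSpace ℝ E] [CompleteSpace E]
  [FiniteDimensional ℝ E]
  {G : Type*} [TopologicalSpace G] [ChartedSpace E G] [Group G] [LieGroup 𝓘(ℝ, E) ∞ G]

/-- The function `g ↦ μ(u⁺, v⁺)(g)` for left invariant vector fields `u⁺`, `v⁺`. -/
def Metric.leftCoeff (μ : Metric E G) (u v : GroupLieAlgebra 𝓘(ℝ, E) G) (g : G) : ℝ :=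
  μ.form g (mulInvariantVectorField u g) (mulInvariantVectorField v g)

theorem Metric.contMDiff_leftCoeff (μ : Metric E G) (u v : GroupLieAlgebra 𝓘(ℝ, E) G) :
    ContMDiff 𝓘(ℝ, E) 𝓘(ℝ, ℝ) 2 (μ.leftCoeff u v) := by
  intro g
  have h : ContMDiffAt 𝓘(ℝ, E) (𝓘(ℝ, E).prod 𝓘(ℝ, ℝ)) 2
      (fun m => TotalSpace.mk' ℝ (E := Bundle.Trivial G ℝ) m
        (μ.form m (mulInvariantVectorField u m) (mulInvariantVectorField v m))) g := by
    apply ContMDiffAt.clm_bundle_apply₂ (F₁ := E) (F₂ := E)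
    · exact (μ.contMDiff.of_le two_le_infty) g
    · exact contMDiff_mulInvariantVectorField_two u g
    · exact contMDiff_mulInvariantVectorField_two v g
  simp only [contMDiffAt_totalSpace] at h
  exact h.2

theorem Metric.IsCartanSchouten.mvfderiv_leftCoeff {μ : Metric E G} (hμ : μ.IsCartanSchouten)
    (x u v : GroupLieAlgebra 𝓘(ℝ, E) G) (g : G) :
    mvfderiv 𝓘(ℝ, E) (μ.leftCoeff u v) g (mulInvariantVectorField x g) =
      (1 / 2) * (μ.leftCoeff ⁅x, u⁆ v g + μ.leftCoeff u ⁅x, v⁆ g) := by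
  have h := hμ (mulInvariantVectorField u) (mulInvariantVectorField v) g
    (mdifferentiableAt_mulInvariantVectorField u) (mdifferentiableAt_mulInvariantVectorField v)
    (mulInvariantVectorField x g)
  rw [connection_mulInvariantVectorField, connection_mulInvariantVectorField, map_smul,
    map_smul] at h
  refine h.trans ?_
  simp only [smul_apply, smul_eq_mul, Metric.leftCoeff]
  ring

/-- The curvature of the connection is skew-symmetric for a Cartan-Schouten metric. -/
theorem Metric.IsCartanSchouten.skew {μ : Metric E G} (hμ : μ.IsCartanSchouten)
    (x y u v : GroupLieAlgebra 𝓘(ℝ, E) G) :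
    μ.form 1 ⁅⁅x, y⁆, u⁆ v + μ.form 1 u ⁅⁅x, y⁆, v⁆ = 0 := by
  have hd : ∀ u v, MDifferentiable 𝓘(ℝ, E) 𝓘(ℝ, ℝ) (μ.leftCoeff u v) := fun u v =>
    (μ.contMDiff_leftCoeff u v).mdifferentiable (by simp)
  have hfun : ∀ z u v, (fun g => mvfderiv 𝓘(ℝ, E) (μ.leftCoeff u v) g (mulInvariantVectorField z g))
      = fun g => (1 / 2 : ℝ) • (μ.leftCoeff ⁅z, u⁆ v + μ.leftCoeff u ⁅z, v⁆) g := fun z u v =>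
    funext fun g => hμ.mvfderiv_leftCoeff z u v g
  have hfd : ∀ z u v, MDifferentiable 𝓘(ℝ, E) 𝓘(ℝ, ℝ)
      (fun g => mvfderiv 𝓘(ℝ, E) (μ.leftCoeff u v) g (mulInvariantVectorField z g)) := by
    intro z u v
    rw [hfun]
    exact ((hd _ _).add (hd _ _)).const_smul (1 / 2 : ℝ)
  have h1 : ∀ z u v, mvfderiv 𝓘(ℝ, E) (μ.leftCoeff u v) 1 z =
      (1 / 2) * (μ.leftCoeff ⁅z, u⁆ v 1 + μ.leftCoeff u ⁅z, v⁆ 1) := by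
    intro z u v
    have := hμ.mvfderiv_leftCoeff z u v 1
    rwa [mulInvariantVectorField_unit] at this
  have h2 : ∀ w z u v, mvfderiv 𝓘(ℝ, E)
      (fun g => mvfderiv 𝓘(ℝ, E) (μ.leftCoeff u v) g (mulInvariantVectorField z g)) 1 w =
      (1 / 4) * (μ.leftCoeff ⁅w, ⁅z, u⁆⁆ v 1 + μ.leftCoeff ⁅z, u⁆ ⁅w, v⁆ 1 +
        (μ.leftCoeff ⁅w, u⁆ ⁅z, v⁆ 1 + μ.leftCoeff u ⁅w, ⁅z, v⁆⁆ 1)) := by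
    intro w z u v
    have h3 : mvfderiv 𝓘(ℝ, E)
        (fun g => (1 / 2 : ℝ) • (μ.leftCoeff ⁅z, u⁆ v + μ.leftCoeff u ⁅z, v⁆) g) 1 w =
        (1 / 2 : ℝ) * (mvfderiv 𝓘(ℝ, E) (μ.leftCoeff ⁅z, u⁆ v) 1 w +
          mvfderiv 𝓘(ℝ, E) (μ.leftCoeff u ⁅z, v⁆) 1 w) := by
      rw [mvfderiv_const_smul_apply _ ((hd _ _ _).add (hd _ _ _)),
        mvfderiv_add (hd _ _ _) (hd _ _ _)]
      rfl
    rw [hfun, h3, h1, h1]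
    ring
  have h3 := mvfderiv_lie (μ.contMDiff_leftCoeff u v) x y (hfd x u v _) (hfd y u v _)
  rw [h1, h2, h2] at h3
  have hc : ∀ u v, μ.leftCoeff u v 1 = μ.form 1 u v := by
    intro u v
    simp only [Metric.leftCoeff, mulInvariantVectorField_unit]
  simp only [hc] at h3
  have h4 : μ.form 1 ⁅⁅x, y⁆, u⁆ v = μ.form 1 ⁅x, ⁅y, u⁆⁆ v - μ.form 1 ⁅y, ⁅x, u⁆⁆ v := by
    rw [lie_lie, map_sub]
    rfl
  have h5 : μ.form 1 u ⁅⁅x, y⁆, v⁆ = μ.form 1 u ⁅x, ⁅y, v⁆⁆ - μ.form 1 u ⁅y, ⁅x, v⁆⁆ := by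
    rw [lie_lie, map_sub]
  -- The mixed terms in ([x,u], [y,v]) cancel on antisymmetrizing. If Q is the sum in the goal,
  -- Jacobi turns the rest into ½ Q = ¼ Q, so Q = 0.
  linarith

/-- A solvable Lie group with a definite Cartan-Schouten metric has derived algebra contained in
the center. -/
theorem Metric.IsCartanSchouten.derived_le_center {μ : Metric E G} (hμ : μ.IsCartanSchouten)
    [LieAlgebra.IsSolvable (GroupLieAlgebra 𝓘(ℝ, E) G)] (c : ℝ)
    (hc : ∀ v : GroupLieAlgebra 𝓘(ℝ, E) G, v ≠ 0 → 0 < c * μ.form 1 v v) :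
    ⁅(⊤ : LieIdeal ℝ (GroupLieAlgebra 𝓘(ℝ, E) G)),
      (⊤ : LieIdeal ℝ (GroupLieAlgebra 𝓘(ℝ, E) G))⁆ ≤
      LieAlgebra.center ℝ (GroupLieAlgebra 𝓘(ℝ, E) G) := by
  let B : GroupLieAlgebra 𝓘(ℝ, E) G →ₗ[ℝ] GroupLieAlgebra 𝓘(ℝ, E) G →ₗ[ℝ] ℝ :=
    LinearMap.mk₂ ℝ (fun u v => c * μ.form 1 u v)
      (fun u u' v => by rw [map_add]; exact mul_add _ _ _)
      (fun a u v => by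
        rw [map_smul]
        exact mul_left_comm c a _)
      (fun u v v' => by rw [map_add]; exact mul_add _ _ _)
      (fun a u v => by
        rw [map_smul]
        exact mul_left_comm c a _)
  refine derived_le_center_of_skew B hc fun x y u v => ?_
  change c * _ + c * _ = (0 : ℝ)
  rw [← mul_add, hμ.skew, mul_zero]

end

/-! ### The adjoint action and its derivative -/

section

variable {E : Type*} [NormedAddCommGroup E] [NormedSpace ℝ E]
  {G : Type*} [TopologicalSpace G] [ChartedSpace E G] [Group G]

/-- The adjoint action of `g⁻¹` on the Lie algebra: the differential at the unit of
`h ↦ g⁻¹ * (h * g)`. -/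
def adInv (g : G) : E →L[ℝ] E :=
  mfderiv 𝓘(ℝ, E) 𝓘(ℝ, E) (fun h : G => g⁻¹ * (h * g)) 1

theorem adInv_one : adInv (E := E) (1 : G) = ContinuousLinearMap.id ℝ E := by
  have h : (fun h : G => (1 : G)⁻¹ * (h * 1)) = id := by ext; simp
  unfold adInv
  rw [h]
  exact mfderiv_id

variable [LieGroup 𝓘(ℝ, E) ∞ G]

theorem adInv_apply (g : G) (u : E) :
    adInv g u = leftTriv g (mfderiv 𝓘(ℝ, E) 𝓘(ℝ, E) (fun h : G => h * g) 1 u : E) :=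
  mfderiv_comp_apply_of_eq (I := 𝓘(ℝ, E)) (I' := 𝓘(ℝ, E)) (I'' := 𝓘(ℝ, E))
    (x := (1 : G)) (y := g) (f := fun h : G => h * g) (g := fun h : G => g⁻¹ * h)
    (mdifferentiableAt_mul_left _ _) (mdifferentiableAt_mul_right _ _) (one_mul g) u

theorem adInv_mul (g h : G) (u : E) : adInv (g * h) u = adInv h (adInv g u) := by
  have hd : ∀ a b : G, MDifferentiableAt 𝓘(ℝ, E) 𝓘(ℝ, E) (fun k : G => a⁻¹ * (k * a)) b :=
    fun a b => (mdifferentiableAt_mul_left _ _).comp b (mdifferentiableAt_mul_right _ _)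
  have h1 := mfderiv_comp_apply_of_eq (I := 𝓘(ℝ, E)) (I' := 𝓘(ℝ, E)) (I'' := 𝓘(ℝ, E))
    (x := (1 : G)) (y := 1) (f := fun k : G => g⁻¹ * (k * g)) (g := fun k : G => h⁻¹ * (k * h))
    (hd _ _) (hd _ _) (by simp) u
  have h2 : (fun k : G => h⁻¹ * (k * h)) ∘ (fun k : G => g⁻¹ * (k * g)) =
      fun k => (g * h)⁻¹ * (k * (g * h)) := by
    ext k
    simp [mul_assoc]
  rw [h2] at h1
  exact h1

/-- When both base points stay at the unit, the coordinate changes are from the chart at the unit to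
itself, hence trivial. Smoothness in tangent coordinates then becomes smoothness of an
operator-valued function. -/
theorem inTangentCoordinates_unit (a : G → G) (ha : ∀ g, a g = 1) (T : G → E →L[ℝ] E) (g₀ g : G) :
    inTangentCoordinates 𝓘(ℝ, E) 𝓘(ℝ, E) (fun _ : G => (1 : G)) a T g₀ g = T g := by
  obtain rfl : a = fun _ => 1 := funext ha
  refine (inTangentCoordinates_eq (I := 𝓘(ℝ, E)) (I' := 𝓘(ℝ, E)) (fun _ : G => (1 : G))
    (fun _ : G => (1 : G)) T (mem_chart_source E (1 : G)) (mem_chart_source E (1 : G))).trans ?_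
  have hc : ∀ v, (tangentBundleCore 𝓘(ℝ, E) G).coordChange (achart E 1) (achart E 1) 1 v = v :=
    (tangentBundleCore 𝓘(ℝ, E) G).coordChange_self (achart E (1 : G)) 1 (mem_chart_source E 1)
  ext v
  exact (hc _).trans (congrArg (T g) (hc v))

theorem contMDiff_adInv : ContMDiff 𝓘(ℝ, E) 𝓘(ℝ, E →L[ℝ] E) ∞ (adInv (E := E) : G → E →L[ℝ] E) := by
  intro g₀
  have h1 : ContMDiff (𝓘(ℝ, E).prod 𝓘(ℝ, E)) 𝓘(ℝ, E) ∞
      (fun p : G × G => p.1⁻¹ * (p.2 * p.1)) :=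
    ((contMDiff_inv 𝓘(ℝ, E) ∞).comp contMDiff_fst).mul (contMDiff_snd.mul contMDiff_fst)
  have h2 : ContMDiffAt 𝓘(ℝ, E) 𝓘(ℝ, E →L[ℝ] E) ∞ (inTangentCoordinates 𝓘(ℝ, E) 𝓘(ℝ, E)
      (fun _ : G => (1 : G)) (fun g => g⁻¹ * (1 * g)) (adInv (E := E)) g₀) g₀ :=
    ContMDiffAt.mfderiv (m := ∞) (n := ∞) (x₀ := g₀)
      (fun g h : G => g⁻¹ * (h * g)) (fun _ => 1) h1.contMDiffAt contMDiffAt_const (by simp)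
  rwa [funext (inTangentCoordinates_unit (fun g => g⁻¹ * (1 * g)) (by simp) (adInv (E := E)) g₀)]
    at h2

theorem mdifferentiableAt_adInv_apply (u : E) (g : G) :
    MDifferentiableAt 𝓘(ℝ, E) 𝓘(ℝ, E) (fun g : G => adInv g u) g :=
  ((contMDiff_adInv.mdifferentiable (by simp)) g).clm_apply mdifferentiableAt_const

theorem fderiv_chartMul_unit (v : E) :
    fderiv ℝ (chartMul G) (extChartAt 𝓘(ℝ, E) (1 : G) 1, extChartAt 𝓘(ℝ, E) (1 : G) 1)
      ((0 : E), v) = v := by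
  have h := mfderiv_chart_mul_left (G := G) (a := extChartAt 𝓘(ℝ, E) (1 : G) 1)
    (by rw [extChartAt_to_inv]; exact mem_extChartAt_source _)
    (eventually_differentiableAt_chartMul.self_of_nhds) v
  exact h.symm.trans (chartField_mulInvariantVectorField_unit (G := G) v)

/-- Right translation of u to g equals left translation of Ad(g⁻¹)u. In the chart this equates two
partial derivatives of the multiplication; differentiating at the unit in the direction x gives the
mixed second derivatives that form the bracket. -/
theorem mvfderiv_adInv_unit (x u : GroupLieAlgebra 𝓘(ℝ, E) G) :
    mvfderiv 𝓘(ℝ, E) (fun g : G => adInv (E := E) g u) 1 x = ⁅u, x⁆ := by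
  rw [mvfderiv_unit_eq_fderiv_chart (mdifferentiableAt_adInv_apply (E := E) u 1)]
  set e := extChartAt 𝓘(ℝ, E) (1 : G) with he
  set A : E → E := (fun g : G => adInv (E := E) g u) ∘ e.symm with hA
  have hA1 : A (e 1) = u := by
    simp only [hA, he, Function.comp_apply, extChartAt_to_inv, adInv_one]
    rfl
  have hAd : HasFDerivAt A (fderiv ℝ A (e 1)) (e 1) := by
    apply DifferentiableAt.hasFDerivAt
    rw [← mdifferentiableAt_iff_differentiableAt]
    exact MDifferentiableAt.comp_of_eq _ (y := (1 : G)) (mdifferentiableAt_adInv_apply (E := E) u 1)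
      (contMDiffAt_extChartAt_unit_symm.mdifferentiableAt (by simp)) (extChartAt_to_inv _)
  have hM := (differentiableAt_fderiv_chartMul (E := E) (G := G)).hasFDerivAt
  rw [← he] at hM
  have hl : HasFDerivAt (fun a : E => fderiv ℝ (chartMul G) (a, e 1) ((0 : E), A a))
      (_ : E →L[ℝ] E) (e 1) :=
    (hM.comp (f := fun a : E => (a, e 1)) (e 1) (hasFDerivAt_prodMk_left (e 1) (e 1))).clm_apply
      ((hasFDerivAt_const (0 : E) (e 1)).prodMk hAd)
  have hr : HasFDerivAt (fun a : E => fderiv ℝ (chartMul G) (e 1, a) (@Prod.mk E E u 0))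
      (_ : E →L[ℝ] E) (e 1) :=
    (hM.comp (f := fun a : E => (e 1, a)) (e 1) (hasFDerivAt_prodMk_right (e 1) (e 1))).clm_apply
      (hasFDerivAt_const (@Prod.mk E E u 0) (e 1))
  have h2 : ∀ᶠ a in nhds (e 1), DifferentiableAt ℝ (chartMul G) (a, e 1) :=
    (Continuous.prodMk_left (e 1)).continuousAt.eventually eventually_differentiableAt_chartMul
  have h2' : ∀ᶠ a in nhds (e 1), DifferentiableAt ℝ (chartMul G) (e 1, a) :=
    (Continuous.prodMk_right (e 1)).continuousAt.eventually eventually_differentiableAt_chartMul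
  have heq : (fun a : E => fderiv ℝ (chartMul G) (a, e 1) ((0 : E), A a)) =ᶠ[nhds (e 1)]
      fun a : E => fderiv ℝ (chartMul G) (e 1, a) (@Prod.mk E E u 0) := by
    filter_upwards [h2, h2', eventually_mem_chart] with a ha ha' hea
    refine (mfderiv_chart_mul_left (G := G) hea.1 ha (A a)).symm.trans
      (Eq.trans ?_ (mfderiv_chart_mul_right (G := G) hea.1 ha' u))
    unfold chartField
    refine congrArg _ ?_
    have h5 := adInv_apply (E := E) (e.symm a) u
    have h6 := mulInvariantVectorField_leftTriv (e.symm a)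
      (mfderiv 𝓘(ℝ, E) 𝓘(ℝ, E) (fun h : G => h * (e.symm a)) 1 u : E)
    rw [← h5] at h6
    exact h6
  have hu := hl.unique (hr.congr_of_eventuallyEq heq)
  have hx : fderiv ℝ (chartMul G) (e 1, e 1) (@Prod.mk E E 0 (fderiv ℝ A (e 1) x)) +
      fderiv ℝ (fderiv ℝ (chartMul G)) (e 1, e 1) (@Prod.mk E E x 0) (@Prod.mk E E 0 (A (e 1))) =
      fderiv ℝ (chartMul G) (e 1, e 1) 0 +
      fderiv ℝ (fderiv ℝ (chartMul G)) (e 1, e 1) (@Prod.mk E E 0 x) (@Prod.mk E E u 0) :=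
    congrArg (fun T : E →L[ℝ] E => T x) hu
  -- Swapping the two arguments of D²m puts the right-hand side in the order used by the bracket
  -- formula.
  have hsymm := ((contDiffAt_chartMul (E := E) (G := G)).isSymmSndFDerivAt (by simpa using two_le_infty)).eq
    (@Prod.mk E E u 0) (@Prod.mk E E 0 x)
  have hone := fderiv_chartMul_unit (G := G) (fderiv ℝ A (e 1) x)
  have hlie := lie_eq_fderiv_fderiv_chartMul u x
  rw [← he] at hsymm hone hlie
  rw [hA1, map_zero, zero_add] at hx
  have habs : ∀ p q r t : E, p = t → p + q = r → t = r - q := by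
    rintro p q r t rfl rfl
    abel
  exact (habs _ _ _ _ hone (hx.trans hsymm.symm)).trans hlie.symm

/-- Multiplicativity, Ad((gh)⁻¹) = Ad(h⁻¹) Ad(g⁻¹), moves the computation from g to the unit. -/
theorem mvfderiv_adInv (g : G) (X : TangentSpace 𝓘(ℝ, E) g) (u : GroupLieAlgebra 𝓘(ℝ, E) G) :
    mvfderiv 𝓘(ℝ, E) (fun g : G => adInv (E := E) g u) g X =
      (⁅(show GroupLieAlgebra 𝓘(ℝ, E) G from adInv (E := E) g u), leftTriv g X⁆ :
        GroupLieAlgebra 𝓘(ℝ, E) G) := by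
  have h1 : (fun h : G => adInv (E := E) h u) ∘ (fun h => g * h) =
      fun h : G => adInv (E := E) h (adInv (E := E) g u) := by
    ext h
    exact adInv_mul (E := E) g h u
  have h2 := mfderiv_comp_apply_of_eq (I := 𝓘(ℝ, E)) (I' := 𝓘(ℝ, E)) (I'' := 𝓘(ℝ, E))
    (x := (1 : G)) (y := g) (f := fun h : G => g * h) (g := fun h : G => adInv (E := E) h u)
    (mdifferentiableAt_adInv_apply (E := E) u g) (mdifferentiableAt_mul_left g 1) (mul_one g)
    (leftTriv g X)
  rw [h1] at h2
  have h3 := mulInvariantVectorField_leftTriv g X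
  have h4 := mvfderiv_adInv_unit (E := E) (G := G) (leftTriv g X) (adInv (E := E) g u)
  refine Eq.trans ?_ (h2.symm.trans h4)
  exact congrArg (fun Y => mvfderiv 𝓘(ℝ, E) (fun g : G => adInv (E := E) g u) g Y) h3.symm

end

/-! ### Product rules and functions with vanishing differential -/

section

variable {E : Type*} [NormedAddCommGroup E] [NormedSpace ℝ E]
  {M : Type*} [TopologicalSpace M] [ChartedSpace E M]
  {F : Type*} [NormedAddCommGroup F] [NormedSpace ℝ F]
  {F' : Type*} [NormedAddCommGroup F'] [NormedSpace ℝ F']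

theorem mvfderiv_eq_fderiv_extChartAt {f : M → F} {g : M} (hf : MDiffAt f g) :
    mvfderiv 𝓘(ℝ, E) f g =
      fderiv ℝ (f ∘ (extChartAt 𝓘(ℝ, E) g).symm) (extChartAt 𝓘(ℝ, E) g g) := by
  refine hf.mvfderiv.trans ?_
  rw [show Set.range 𝓘(ℝ, E) = Set.univ by simp, fderivWithin_univ]
  rfl

theorem differentiableAt_comp_extChartAt_symm {f : M → F} {g : M} (hf : MDiffAt f g) :
    DifferentiableAt ℝ (f ∘ (extChartAt 𝓘(ℝ, E) g).symm) (extChartAt 𝓘(ℝ, E) g g) := by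
  have h := hf.mdifferentiableWithinAt (s := Set.univ)
    |>.differentiableWithinAt_comp_extChartAt_symm
  rwa [Set.preimage_univ, show Set.univ ∩ Set.range 𝓘(ℝ, E) = Set.univ by simp,
    differentiableWithinAt_univ] at h

/-- The product rule for the evaluation of a field of continuous linear maps. -/
theorem mvfderiv_clm_apply {c : M → F →L[ℝ] F'} {u : M → F} {g : M} (hc : MDiffAt c g)
    (hu : MDiffAt u g) (X : TangentSpace 𝓘(ℝ, E) g) :
    mvfderiv 𝓘(ℝ, E) (fun h => c h (u h)) g X =
      c g (mvfderiv 𝓘(ℝ, E) u g X) + mvfderiv 𝓘(ℝ, E) c g X (u g) := by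
  rw [mvfderiv_eq_fderiv_extChartAt (hc.clm_apply hu), mvfderiv_eq_fderiv_extChartAt hc,
    mvfderiv_eq_fderiv_extChartAt hu]
  have h := fderiv_clm_apply (differentiableAt_comp_extChartAt_symm hc)
    (differentiableAt_comp_extChartAt_symm hu)
  refine (congrArg (fun T : E →L[ℝ] F' => T X) h).trans ?_
  have h0 := extChartAt_to_inv (I := 𝓘(ℝ, E)) g
  simp only [Function.comp_apply, h0]
  rfl

theorem mvfderiv_clm_const_apply (L : F →L[ℝ] F') {u : M → F} {g : M}
    (hu : MDiffAt u g) (X : TangentSpace 𝓘(ℝ, E) g) :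
    mvfderiv 𝓘(ℝ, E) (fun h => L (u h)) g X = L (mvfderiv 𝓘(ℝ, E) u g X) := by
  rw [mvfderiv_clm_apply mdifferentiableAt_const hu, mvfderiv_const]
  simp

theorem mvfderiv_apply_const {c : M → F →L[ℝ] F'} {g : M} (hc : MDiffAt c g)
    (X : TangentSpace 𝓘(ℝ, E) g) (v : F) :
    mvfderiv 𝓘(ℝ, E) (fun h => c h v) g X = mvfderiv 𝓘(ℝ, E) c g X v := by
  rw [mvfderiv_clm_apply hc mdifferentiableAt_const, mvfderiv_const]
  simp

/-- A function with vanishing differential on a preconnected open set is constant there. -/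
theorem eq_of_mvfderiv_eq_zero [IsManifold 𝓘(ℝ, E) 1 M] {f : M → F} {U : Set M} (hU : IsOpen U)
    (hU' : IsPreconnected U) (hf : ∀ g ∈ U, MDiffAt f g)
    (hf' : ∀ g ∈ U, mvfderiv 𝓘(ℝ, E) f g = 0) {a b : M} (ha : a ∈ U) (hb : b ∈ U) :
    f a = f b := by
  -- Local constancy holds on the preimage of a ball in the chart, by convexity; preconnectedness
  -- then makes it global.
  have hloc : ∀ g ∈ U, ∀ᶠ h in nhds g, f h = f g := by
    intro g hg
    set e := extChartAt 𝓘(ℝ, E) g with he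
    have h1 : ∀ᶠ p in nhds (e g), p ∈ e.target ∧ e.symm p ∈ U :=
      Filter.Eventually.and (extChartAt_target_mem_nhds g)
        ((continuousAt_extChartAt_symm g).eventually (by
          rw [extChartAt_to_inv]
          exact hU.mem_nhds hg))
    obtain ⟨r, hr, hball⟩ := Metric.eventually_nhds_iff_ball.1 h1
    have hder : ∀ p ∈ Metric.ball (e g) r, HasFDerivAt (f ∘ e.symm) (0 : E →L[ℝ] F) p := by
      intro p hp
      obtain ⟨hp1, hp2⟩ := hball p hp
      have hs : MDifferentiableAt 𝓘(ℝ, E) 𝓘(ℝ, E) e.symm p := by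
        have := mdifferentiableWithinAt_extChartAt_symm (I := 𝓘(ℝ, E)) (x := g) hp1
        rwa [show Set.range 𝓘(ℝ, E) = Set.univ by simp, mdifferentiableWithinAt_univ] at this
      have hz : mfderiv 𝓘(ℝ, E) 𝓘(ℝ, F) f (e.symm p) = 0 := hf' _ hp2
      have h2 := (hf _ hp2).hasMFDerivAt.comp p hs.hasMFDerivAt
      rw [hz] at h2
      have h3 : HasMFDerivAt 𝓘(ℝ, E) 𝓘(ℝ, F) (f ∘ e.symm) p (0 : E →L[ℝ] F) := h2
      exact h3.hasFDerivAt
    have hconst : ∀ p ∈ Metric.ball (e g) r, (f ∘ e.symm) p = (f ∘ e.symm) (e g) := by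
      intro p hp
      refine (convex_ball (e g) r).is_const_of_fderivWithin_eq_zero (𝕜 := ℝ)
        (fun q hq => (hder q hq).differentiableAt.differentiableWithinAt) (fun q hq => ?_) hp
        (Metric.mem_ball_self hr)
      exact ((hder q hq).hasFDerivWithinAt).fderivWithin
        (Metric.isOpen_ball.uniqueDiffWithinAt hq)
    have h3 : ∀ᶠ h in nhds g, e h ∈ Metric.ball (e g) r :=
      (continuousAt_extChartAt g).eventually (Metric.ball_mem_nhds _ hr)
    filter_upwards [h3, extChartAt_source_mem_nhds (I := 𝓘(ℝ, E)) g] with h hh hs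
    have h4 := hconst _ hh
    rwa [Function.comp_apply, Function.comp_apply, e.left_inv hs, extChartAt_to_inv] at h4
  have : PreconnectedSpace U := isPreconnected_iff_preconnectedSpace.1 hU'
  have hlc : IsLocallyConstant (fun x : U => f x) := by
    rw [IsLocallyConstant.iff_eventually_eq]
    rintro ⟨x, hx⟩
    exact (continuous_subtype_val.tendsto (⟨x, hx⟩ : U)).eventually (hloc x hx)
  exact hlc.apply_eq_of_preconnectedSpace ⟨a, ha⟩ ⟨b, hb⟩

end

/-! ### Representatives of the connected components -/

section

variable {G : Type*} [TopologicalSpace G]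

/-- A representative of the connected component of `g`, chosen once for each component. -/
def componentRep (g : G) : G := Quotient.out (ConnectedComponents.mk g)

theorem mem_connectedComponent_componentRep (g : G) : g ∈ connectedComponent (componentRep g) := by
  rw [← ConnectedComponents.coe_eq_coe']
  exact (Quotient.out_eq (ConnectedComponents.mk g)).symm

theorem eventually_componentRep_eq [LocallyConnectedSpace G] (g : G) :
    ∀ᶠ h in nhds g, componentRep h = componentRep g := by
  filter_upwards [(isOpen_connectedComponent (x := g)).mem_nhds
    mem_connectedComponent] with h hh
  rw [← ConnectedComponents.coe_eq_coe'] at hh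
  unfold componentRep
  exact congrArg Quotient.out hh

theorem componentRep_inv_mul_mem [Group G] [ContinuousMul G] (g : G) :
    (componentRep g)⁻¹ * g ∈ connectedComponent (1 : G) := by
  have h := (continuous_const_mul (componentRep g)⁻¹).mapsTo_connectedComponent (componentRep g)
    (mem_connectedComponent_componentRep g)
  rwa [inv_mul_cancel] at h

end

/-! ### The square root of the adjoint representation -/

section

variable {E : Type*} [NormedAddCommGroup E] [NormedSpace ℝ E]
  {G : Type*} [TopologicalSpace G] [ChartedSpace E G] [Group G]

/-- The square root of the adjoint representation of the identity component of a 2-step nilpotent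
group. -/
def sqrtAd (g : G) : E →L[ℝ] E :=
  -- With N = 1 - Ad(g⁻¹) and N² = 0, the root of Ad(g) = 1 + N is 1 + N/2 = (3 - Ad(g⁻¹))/2. It is
  -- polynomial in Ad(g⁻¹), so no logarithm on the group is needed.
  (1 / 2 : ℝ) • ((3 : ℝ) • ContinuousLinearMap.id ℝ E - adInv g)

/-- `sqrtAd` transported to all the components by left translations. -/
def componentSqrtAd (g : G) : E →L[ℝ] E := sqrtAd ((componentRep g)⁻¹ * g)

/-- Components are open, so the arbitrary choice of representatives is locally constant and does not
affect smoothness or derivatives. -/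
theorem eventually_componentSqrtAd_eq (g : G) :
    (componentSqrtAd (E := E) : G → E →L[ℝ] E) =ᶠ[nhds g]
      (sqrtAd (E := E)) ∘ fun h => (componentRep g)⁻¹ * h := by
  have := ChartedSpace.locallyConnectedSpace E G
  filter_upwards [eventually_componentRep_eq g] with h hh
  simp [componentSqrtAd, hh]

end

section

variable {E : Type*} [NormedAddCommGroup E] [NormedSpace ℝ E]
  {G : Type*} [TopologicalSpace G] [ChartedSpace E G] [Group G] [LieGroup 𝓘(ℝ, E) ∞ G]

theorem contMDiff_sqrtAd :
    ContMDiff 𝓘(ℝ, E) 𝓘(ℝ, E →L[ℝ] E) ∞ (sqrtAd (E := E) : G → E →L[ℝ] E) := by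
  have h : ContMDiff 𝓘(ℝ, E) 𝓘(ℝ, E →L[ℝ] E) ∞
      (fun g : G => (3 : ℝ) • ContinuousLinearMap.id ℝ E - adInv g) :=
    contMDiff_const.sub contMDiff_adInv
  have hc : ContMDiff 𝓘(ℝ, E) 𝓘(ℝ, ℝ) ∞ (fun _ : G => (1 / 2 : ℝ)) := contMDiff_const
  exact hc.smul h

theorem contMDiff_componentSqrtAd :
    ContMDiff 𝓘(ℝ, E) 𝓘(ℝ, E →L[ℝ] E) ∞ (componentSqrtAd (E := E) : G → E →L[ℝ] E) := fun g =>
  (contMDiff_sqrtAd.comp (contMDiff_mul_left (a := (componentRep g)⁻¹))).contMDiffAt.congr_of_eventuallyEq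
    (eventually_componentSqrtAd_eq g)

theorem leftTriv_mul_left (a g : G) (X : TangentSpace 𝓘(ℝ, E) g) :
    leftTriv (a * g) (mfderiv 𝓘(ℝ, E) 𝓘(ℝ, E) (fun h : G => a * h) g X) = leftTriv g X := by
  have h1 := mfderiv_comp_apply (I := 𝓘(ℝ, E)) (I' := 𝓘(ℝ, E)) (I'' := 𝓘(ℝ, E))
    (x := g) (f := fun h : G => a * h) (g := fun h : G => (a * g)⁻¹ * h)
    (mdifferentiableAt_mul_left _ _) (mdifferentiableAt_mul_left _ _) X
  have h2 : ((fun h : G => (a * g)⁻¹ * h) ∘ fun h : G => a * h) = fun h => g⁻¹ * h := by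
    ext h
    simp [mul_assoc]
  rw [h2] at h1
  exact h1.symm

variable [CompleteSpace E] [FiniteDimensional ℝ E]

section TwoStep

variable (h2 : ∀ x y z : GroupLieAlgebra 𝓘(ℝ, E) G, ⁅⁅x, y⁆, z⁆ = 0)
include h2

/-- The derivative of [Ad(g⁻¹)u, w] in g is a double bracket, so it vanishes and the value at the
unit persists on the identity component. -/
theorem lie_adInv {g : G} (hg : g ∈ connectedComponent (1 : G))
    (u w : GroupLieAlgebra 𝓘(ℝ, E) G) :
    (⁅(show GroupLieAlgebra 𝓘(ℝ, E) G from adInv (E := E) g u), w⁆ :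
      GroupLieAlgebra 𝓘(ℝ, E) G) = ⁅u, w⁆ := by
  let L : E →L[ℝ] E := bracketRight w
  have hd : ∀ h : G, MDifferentiableAt 𝓘(ℝ, E) 𝓘(ℝ, E) (fun h => adInv (E := E) h u) h :=
    fun h => mdifferentiableAt_adInv_apply (E := E) u h
  have := ChartedSpace.locallyConnectedSpace E G
  have h := eq_of_mvfderiv_eq_zero (E := E) (f := fun h : G => L (adInv (E := E) h u))
    (isOpen_connectedComponent (x := (1 : G))) isPreconnected_connectedComponent
    (fun h _ => mdifferentiableAt_const.clm_apply (hd h))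
    (fun h _ => by
      ext X
      refine (mvfderiv_clm_const_apply L (hd h) X).trans ?_
      rw [mvfderiv_adInv]
      exact h2 _ _ _) hg mem_connectedComponent
  refine h.trans ?_
  rw [adInv_one]
  rfl

/-- The derivative of Ad(g⁻¹)z along X is [Ad(g⁻¹)z, θ(X)] = [z, θ(X)] = 0. -/
theorem adInv_central {g : G} (hg : g ∈ connectedComponent (1 : G))
    (z : GroupLieAlgebra 𝓘(ℝ, E) G) (hz : ∀ w : GroupLieAlgebra 𝓘(ℝ, E) G, ⁅z, w⁆ = 0) :
    adInv (E := E) g z = z := by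
  have hd : ∀ h : G, MDifferentiableAt 𝓘(ℝ, E) 𝓘(ℝ, E) (fun h => adInv (E := E) h z) h :=
    fun h => mdifferentiableAt_adInv_apply (E := E) z h
  have := ChartedSpace.locallyConnectedSpace E G
  have h := eq_of_mvfderiv_eq_zero (E := E) (f := fun h : G => adInv (E := E) h z)
    (isOpen_connectedComponent (x := (1 : G))) isPreconnected_connectedComponent
    (fun h _ => hd h)
    (fun h hh => by
      ext X
      rw [mvfderiv_adInv]
      exact (lie_adInv h2 hh z (leftTriv h X)).trans (hz _)) hg mem_connectedComponent
  refine h.trans ?_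
  rw [adInv_one]
  rfl

theorem sqrtAd_lie {g : G} (hg : g ∈ connectedComponent (1 : G))
    (x u : GroupLieAlgebra 𝓘(ℝ, E) G) :
    sqrtAd (E := E) g (⁅x, u⁆ : GroupLieAlgebra 𝓘(ℝ, E) G) =
      (⁅x, u⁆ : GroupLieAlgebra 𝓘(ℝ, E) G) := by
  have h : ∀ a b : E, b = a → (1 / 2 : ℝ) • ((3 : ℝ) • a - b) = a := by
    rintro a b rfl
    module
  exact h _ _ (adInv_central h2 hg ⁅x, u⁆ (h2 x u))

/-- A kernel vector satisfies Ad(g⁻¹)u = 3u. Bracketing with w gives 3[u,w] = [u,w], so u is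
central, hence fixed by Ad(g⁻¹), and 3u = u. -/
theorem sqrtAd_injective {g : G} (hg : g ∈ connectedComponent (1 : G))
    (u : GroupLieAlgebra 𝓘(ℝ, E) G) (hu : sqrtAd (E := E) g u = 0) : u = 0 := by
  have h : ∀ a b : E, (1 / 2 : ℝ) • ((3 : ℝ) • a - b) = 0 → b = (3 : ℝ) • a := by
    intro a b hab
    rw [smul_eq_zero_iff_right (by norm_num), sub_eq_zero] at hab
    exact hab.symm
  have h3 : adInv (E := E) g u = (3 : ℝ) • u := h _ _ hu
  have hc : ∀ w : GroupLieAlgebra 𝓘(ℝ, E) G, ⁅u, w⁆ = 0 := by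
    intro w
    have h4 := lie_adInv h2 hg u w
    have h5 : (⁅(3 : ℝ) • u, w⁆ : GroupLieAlgebra 𝓘(ℝ, E) G) = ⁅u, w⁆ := by
      rw [← h4]
      exact congrArg (fun t : GroupLieAlgebra 𝓘(ℝ, E) G => ⁅t, w⁆) h3.symm
    rw [smul_lie] at h5
    have h6 : (2 : ℝ) • ⁅u, w⁆ = 0 := by
      have : (2 : ℝ) • ⁅u, w⁆ = (3 : ℝ) • ⁅u, w⁆ - ⁅u, w⁆ := by module
      rw [this, h5, sub_self]
    exact (smul_eq_zero_iff_right (by norm_num)).1 h6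
  have h4 : (3 : ℝ) • u = u := h3.symm.trans (adInv_central h2 hg u hc)
  have h6 : (2 : ℝ) • u = 0 := by
    have : (2 : ℝ) • u = (3 : ℝ) • u - u := by module
    rw [this, h4, sub_self]
  exact (smul_eq_zero_iff_right (by norm_num)).1 h6

theorem mvfderiv_sqrtAd {g : G} (hg : g ∈ connectedComponent (1 : G))
    (X : TangentSpace 𝓘(ℝ, E) g) (u : GroupLieAlgebra 𝓘(ℝ, E) G) :
    mvfderiv 𝓘(ℝ, E) (sqrtAd (E := E) : G → E →L[ℝ] E) g X u =
      (1 / 2 : ℝ) • (⁅leftTriv g X, u⁆ : GroupLieAlgebra 𝓘(ℝ, E) G) := by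
  have hA : MDifferentiableAt 𝓘(ℝ, E) 𝓘(ℝ, E →L[ℝ] E) (adInv (E := E) : G → E →L[ℝ] E) g :=
    contMDiff_adInv.mdifferentiable (by simp) g
  have hc : MDifferentiableAt 𝓘(ℝ, E) 𝓘(ℝ, E →L[ℝ] E)
      (fun _ : G => (3 : ℝ) • ContinuousLinearMap.id ℝ E) g := mdifferentiableAt_const
  have h3 : mvfderiv 𝓘(ℝ, E) (sqrtAd (E := E) : G → E →L[ℝ] E) g X =
      (1 / 2 : ℝ) • (0 - mvfderiv 𝓘(ℝ, E) (adInv (E := E) : G → E →L[ℝ] E) g X) := by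
    refine (mvfderiv_const_smul_apply (1 / 2 : ℝ) (hc.sub hA) X).trans ?_
    rw [mvfderiv_sub hc hA, mvfderiv_const]
    rfl
  have h4 : mvfderiv 𝓘(ℝ, E) (adInv (E := E) : G → E →L[ℝ] E) g X u =
      (⁅u, leftTriv g X⁆ : GroupLieAlgebra 𝓘(ℝ, E) G) := by
    exact (mvfderiv_apply_const hA X u).symm.trans
      ((mvfderiv_adInv g X u).trans (lie_adInv h2 hg u _))
  rw [h3, ← lie_skew]
  change (1 / 2 : ℝ) • ((0 : E) - mvfderiv 𝓘(ℝ, E) (adInv (E := E) : G → E →L[ℝ] E) g X u) = _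
  rw [h4]
  exact congrArg (fun t : E => (1 / 2 : ℝ) • t) (zero_sub _)

theorem mvfderiv_componentSqrtAd (g : G) (X : TangentSpace 𝓘(ℝ, E) g)
    (u : GroupLieAlgebra 𝓘(ℝ, E) G) :
    mvfderiv 𝓘(ℝ, E) (componentSqrtAd (E := E) : G → E →L[ℝ] E) g X u =
      (1 / 2 : ℝ) • (⁅leftTriv g X, u⁆ : GroupLieAlgebra 𝓘(ℝ, E) G) := by
  have := continuousMul_of_contMDiffMul 𝓘(ℝ, E) ∞ (G := G)
  have hs : MDifferentiable 𝓘(ℝ, E) 𝓘(ℝ, E →L[ℝ] E) (sqrtAd (E := E) : G → E →L[ℝ] E) :=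
    contMDiff_sqrtAd.mdifferentiable (by simp)
  have h3 : mvfderiv 𝓘(ℝ, E) (componentSqrtAd (E := E) : G → E →L[ℝ] E) g X =
      mvfderiv 𝓘(ℝ, E) (sqrtAd (E := E) : G → E →L[ℝ] E) ((componentRep g)⁻¹ * g)
        (mfderiv 𝓘(ℝ, E) 𝓘(ℝ, E) (fun h : G => (componentRep g)⁻¹ * h) g X) := by
    have h4 := mfderiv_comp_apply (I := 𝓘(ℝ, E)) (I' := 𝓘(ℝ, E)) (I'' := 𝓘(ℝ, E →L[ℝ] E))
      (x := g) (f := fun h : G => (componentRep g)⁻¹ * h) (g := sqrtAd (E := E))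
      (hs _) (mdifferentiableAt_mul_left _ _) X
    rw [← (eventually_componentSqrtAd_eq g).mfderiv_eq] at h4
    exact h4
  rw [h3]
  refine (mvfderiv_sqrtAd h2 (componentRep_inv_mul_mem g) _ u).trans ?_
  rw [leftTriv_mul_left]

/-- This says that Sθ carries ∇ to the trivial flat connection. The product rule yields S(dθ(Y)(X))
+ ½[θ(X), θ(Y)], and S may be put in front of the bracket because it fixes brackets. -/
theorem mvfderiv_componentSqrtAd_leftTrivField {Y : Π h : G, TangentSpace 𝓘(ℝ, E) h} {g : G}
    (hY : MDiffAt (T% Y) g) (X : TangentSpace 𝓘(ℝ, E) g) :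
    mvfderiv 𝓘(ℝ, E) (fun h => componentSqrtAd (E := E) h (leftTrivField Y h)) g X =
      componentSqrtAd (E := E) g (leftTriv g (connection E G Y g X)) := by
  have := continuousMul_of_contMDiffMul 𝓘(ℝ, E) ∞ (G := G)
  have hs : MDifferentiableAt 𝓘(ℝ, E) 𝓘(ℝ, E →L[ℝ] E)
      (componentSqrtAd (E := E) : G → E →L[ℝ] E) g :=
    contMDiff_componentSqrtAd.mdifferentiable (by simp) g
  have h3 : leftTriv g (connection E G Y g X) =
      leftTrivDeriv Y g X + (1 / 2 : ℝ) • (⁅leftTriv g X, leftTriv g (Y g)⁆ :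
        GroupLieAlgebra 𝓘(ℝ, E) G) := by
    have h4 : connection E G Y g X = mulInvariantVectorField
      (leftTrivDeriv Y g X + (1 / 2 : ℝ) • (⁅leftTriv g X, leftTriv g (Y g)⁆ :
        GroupLieAlgebra 𝓘(ℝ, E) G)) g := rfl
    rw [h4, leftTriv_mulInvariantVectorField]
  have h5 : componentSqrtAd (E := E) g ((⁅leftTriv g X, leftTriv g (Y g)⁆ :
        GroupLieAlgebra 𝓘(ℝ, E) G)) = (⁅leftTriv g X, leftTriv g (Y g)⁆ :
        GroupLieAlgebra 𝓘(ℝ, E) G) :=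
    sqrtAd_lie h2 (componentRep_inv_mul_mem g) _ _
  rw [mvfderiv_clm_apply hs (mdifferentiableAt_leftTriv hY), h3]
  refine Eq.trans ?_ (map_add (componentSqrtAd (E := E) g) _ _).symm
  refine congrArg₂ (fun a b : E => a + b) rfl ?_
  refine (mvfderiv_componentSqrtAd h2 g X (leftTriv g (Y g))).trans ?_
  refine Eq.trans ?_ (map_smul (componentSqrtAd (E := E) g) _ _).symm
  exact congrArg (fun t : E => (1 / 2 : ℝ) • t) h5.symm

end TwoStep

end

/-! ### The metric pulled back along the parallel trivialization -/

section

variable {E : Type*} [NormedAddCommGroup E] [NormedSpace ℝ E]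
  {G : Type*} [TopologicalSpace G] [ChartedSpace E G] [Group G]

/-- The pullback of a continuous bilinear form by a continuous linear map. -/
def pullForm (B : E →L[ℝ] E →L[ℝ] ℝ) (S : E →L[ℝ] E) : E →L[ℝ] E →L[ℝ] ℝ :=
  ((ContinuousLinearMap.compL ℝ E E ℝ).flip S) ∘L B ∘L S

theorem pullForm_apply (B : E →L[ℝ] E →L[ℝ] ℝ) (S : E →L[ℝ] E) (v w : E) :
    pullForm B S v w = B (S v) (S w) := rfl

/-- `componentSqrtAd` composed with the left trivialization. -/
def twistedTriv (g : G) : E →L[ℝ] E := componentSqrtAd (E := E) g ∘L (leftTriv g : E →L[ℝ] E)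

variable [LieGroup 𝓘(ℝ, E) ∞ G]

theorem contMDiffAt_leftTriv_inTangentCoordinates (g₀ : G) :
    ContMDiffAt 𝓘(ℝ, E) 𝓘(ℝ, E →L[ℝ] E) ∞ (inTangentCoordinates 𝓘(ℝ, E) 𝓘(ℝ, E)
      (fun g : G => g) (fun _ => (1 : G)) (fun g => (leftTriv g : E →L[ℝ] E)) g₀) g₀ := by
  have h1 : ContMDiff (𝓘(ℝ, E).prod 𝓘(ℝ, E)) 𝓘(ℝ, E) ∞ (fun p : G × G => p.1⁻¹ * p.2) :=
    ((contMDiff_inv 𝓘(ℝ, E) ∞).comp contMDiff_fst).mul contMDiff_snd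
  have h2 : ContMDiffAt 𝓘(ℝ, E) 𝓘(ℝ, E →L[ℝ] E) ∞ (inTangentCoordinates 𝓘(ℝ, E) 𝓘(ℝ, E)
      (fun g : G => g) (fun g => g⁻¹ * g) (fun g => (leftTriv g : E →L[ℝ] E)) g₀) g₀ :=
    ContMDiffAt.mfderiv (m := ∞) (n := ∞) (x₀ := g₀)
      (fun g h : G => g⁻¹ * h) (fun g => g) h1.contMDiffAt contMDiffAt_id (by simp)
  rwa [show (fun g : G => g⁻¹ * g) = fun _ => 1 from funext fun g => inv_mul_cancel g] at h2

/-- In the trivialization around g₀ the form becomes the pullback of B by S(g) composed with the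
coordinate expression of θ, both smooth operator-valued functions. -/
theorem contMDiff_pullForm_twistedTriv (B : E →L[ℝ] E →L[ℝ] ℝ) :
    ContMDiff 𝓘(ℝ, E) (𝓘(ℝ, E).prod 𝓘(ℝ, E →L[ℝ] E →L[ℝ] ℝ)) ∞
    (fun g : G ↦ TotalSpace.mk' (E →L[ℝ] E →L[ℝ] ℝ)
      (E := fun g : G ↦ TangentSpace 𝓘(ℝ, E) g →L[ℝ] TangentSpace 𝓘(ℝ, E) g →L[ℝ] ℝ) g
      (pullForm (E := E) B (twistedTriv (E := E) g))) := by
  intro g₀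
  rw [contMDiffAt_hom_bundle]
  refine ⟨contMDiffAt_id, ?_⟩
  set S : G → E →L[ℝ] E := fun g => componentSqrtAd (E := E) g ∘L
    inTangentCoordinates 𝓘(ℝ, E) 𝓘(ℝ, E) (fun g : G => g) (fun _ => (1 : G))
      (fun g => (leftTriv g : E →L[ℝ] E)) g₀ g with hS
  have h1 : ContMDiffAt 𝓘(ℝ, E) 𝓘(ℝ, E →L[ℝ] E) ∞ S g₀ :=
    (contMDiff_componentSqrtAd g₀).clm_comp (contMDiffAt_leftTriv_inTangentCoordinates g₀)
  have h2 : ContMDiffAt 𝓘(ℝ, E) 𝓘(ℝ, E →L[ℝ] E →L[ℝ] ℝ) ∞ (fun g => pullForm B (S g)) g₀ :=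
    ((contMDiffAt_const (c := (ContinuousLinearMap.compL ℝ E E ℝ).flip)).clm_apply h1).clm_comp
      ((contMDiffAt_const (c := B)).clm_comp h1)
  refine h2.congr_of_eventuallyEq ?_
  filter_upwards [(trivializationAt E (TangentSpace 𝓘(ℝ, E)) g₀).open_baseSet.mem_nhds
    (FiberBundle.mem_baseSet_trivializationAt' g₀)] with g hg
  have hSg : ∀ v : E, S g v =
      twistedTriv (E := E) g ((trivializationAt E (TangentSpace 𝓘(ℝ, E)) g₀).symm g v : E) := by
    intro v
    refine congrArg (componentSqrtAd (E := E) g) ?_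
    have h4 : ∀ w : E, (trivializationAt E (TangentSpace 𝓘(ℝ, E)) (1 : G)).continuousLinearMapAt ℝ
        (1 : G) w = w := by
      intro w
      rw [TangentBundle.continuousLinearMapAt_trivializationAt (mem_chart_source E (1 : G)),
        mfderiv_extChartAt_self]
      rfl
    have h5 : ∀ v : E, (trivializationAt E (TangentSpace 𝓘(ℝ, E)) g₀).symmL ℝ g v =
        (trivializationAt E (TangentSpace 𝓘(ℝ, E)) g₀).symm g v :=
      (trivializationAt E (TangentSpace 𝓘(ℝ, E)) g₀).symmL_apply hg
    exact (h4 (leftTriv g ((trivializationAt E (TangentSpace 𝓘(ℝ, E)) g₀).symmL ℝ g v))).trans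
      (congrArg (fun X : TangentSpace 𝓘(ℝ, E) g => (leftTriv g X : E)) (h5 v))
  ext v w
  have h3 := inCoordinates_apply_eq₂ (𝕜 := ℝ) (F₁ := E) (F₂ := E) (F₃ := ℝ)
    (E₁ := (TangentSpace 𝓘(ℝ, E) : G → Type _)) (E₂ := (TangentSpace 𝓘(ℝ, E) : G → Type _))
    (E₃ := Bundle.Trivial G ℝ) (x₀ := g₀) (x := g) (ϕ := pullForm (E := E) B (twistedTriv (E := E) g)) (v := v)
    (w := w) hg hg (Set.mem_univ _)
  have hl : ∀ r : ℝ, (trivializationAt ℝ (Bundle.Trivial G ℝ) g₀).linearMapAt ℝ g r = r := by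
    intro r
    simp only [Trivial.fiberBundle_trivializationAt', Trivial.linearMapAt_trivialization]
    rfl
  refine h3.trans ((hl _).trans ?_)
  rw [pullForm_apply, hSg, hSg]
  rfl

variable [CompleteSpace E] [FiniteDimensional ℝ E]

theorem twistedTriv_injective (h2 : ∀ x y z : GroupLieAlgebra 𝓘(ℝ, E) G, ⁅⁅x, y⁆, z⁆ = 0)
    (g : G) (v : E) (hv : twistedTriv (E := E) g v = 0) : v = 0 := by
  have := continuousMul_of_contMDiffMul 𝓘(ℝ, E) ∞ (G := G)
  have h3 := sqrtAd_injective h2 (componentRep_inv_mul_mem g) _ hv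
  have h4 := mulInvariantVectorField_leftTriv g v
  rw [← h4]
  refine (congrArg (fun u => mulInvariantVectorField (I := 𝓘(ℝ, E)) u g) h3).trans ?_
  exact map_zero (leftTrivSymm g)

/-- The metric obtained by pulling back a nondegenerate symmetric bilinear form along
`twistedTriv`. -/
def twistedMetric (h2 : ∀ x y z : GroupLieAlgebra 𝓘(ℝ, E) G, ⁅⁅x, y⁆, z⁆ = 0)
    (B : E →L[ℝ] E →L[ℝ] ℝ) (hB : ∀ v w, B v w = B w v)
    (hB' : ∀ v, v ≠ 0 → B v v ≠ 0) : Metric E G where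
  form g := pullForm (E := E) B (twistedTriv (E := E) g)
  symm g v w := hB _ _
  nondegenerate g v hv := by
    by_contra h
    exact hB' _ (fun h0 => h (twistedTriv_injective h2 g v h0)) (hv v)
  contMDiff := contMDiff_pullForm_twistedTriv B

/-- The product rule for the constant form B, applied to the functions Sθ(Y) and Sθ(Z), whose
derivatives are Sθ of the covariant derivatives. -/
theorem twistedMetric_isCartanSchouten
    (h2 : ∀ x y z : GroupLieAlgebra 𝓘(ℝ, E) G, ⁅⁅x, y⁆, z⁆ = 0)
    (B : E →L[ℝ] E →L[ℝ] ℝ) (hB : ∀ v w, B v w = B w v) (hB' : ∀ v, v ≠ 0 → B v v ≠ 0) :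
    (twistedMetric (G := G) h2 B hB hB').IsCartanSchouten := by
  intro Y Z g hY hZ X
  have hs : MDifferentiableAt 𝓘(ℝ, E) 𝓘(ℝ, E →L[ℝ] E)
      (componentSqrtAd (E := E) : G → E →L[ℝ] E) g :=
    contMDiff_componentSqrtAd.mdifferentiable (by simp) g
  have hy : MDifferentiableAt 𝓘(ℝ, E) 𝓘(ℝ, E)
      (fun h => componentSqrtAd (E := E) h (leftTrivField Y h)) g :=
    hs.clm_apply (mdifferentiableAt_leftTriv hY)
  have hz : MDifferentiableAt 𝓘(ℝ, E) 𝓘(ℝ, E)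
      (fun h => componentSqrtAd (E := E) h (leftTrivField Z h)) g :=
    hs.clm_apply (mdifferentiableAt_leftTriv hZ)
  have h3 := mvfderiv_clm_apply (c := fun h => B (componentSqrtAd (E := E) h (leftTrivField Y h)))
    (mdifferentiableAt_const.clm_apply hy) hz X
  rw [mvfderiv_clm_const_apply B hy, mvfderiv_componentSqrtAd_leftTrivField h2 hY,
    mvfderiv_componentSqrtAd_leftTrivField h2 hZ] at h3
  exact h3.trans (add_comm _ _)

/-- A 2-step nilpotent Lie group carries a Cartan-Schouten metric of each definite sign. -/
theorem exists_isCartanSchouten_of_derived_le_center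
    (h2 : ⁅(⊤ : LieIdeal ℝ (GroupLieAlgebra 𝓘(ℝ, E) G)),
      (⊤ : LieIdeal ℝ (GroupLieAlgebra 𝓘(ℝ, E) G))⁆ ≤
      LieAlgebra.center ℝ (GroupLieAlgebra 𝓘(ℝ, E) G)) (c : ℝ) (hc : c ≠ 0) :
    ∃ μ : Metric E G, μ.IsCartanSchouten ∧
      ∀ (g : G) (v : TangentSpace 𝓘(ℝ, E) g), v ≠ 0 → 0 < c * μ.form g v v := by
  have h2' : ∀ x y z : GroupLieAlgebra 𝓘(ℝ, E) G, ⁅⁅x, y⁆, z⁆ = 0 := by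
    intro x y z
    have h3 := (LieModule.mem_maxTrivSubmodule _ _ _ _).1 (h2 (LieSubmodule.lie_mem_lie
      (LieSubmodule.mem_top x) (LieSubmodule.mem_top y))) z
    rw [← lie_skew, h3, neg_zero]
  let e := toEuclidean (E := E)
  -- The factor c gives B its sign, and c · B = c² ⟨·,·⟩ is positive definite in both cases.
  -- `toEuclidean` supplies an inner product, since the norm of E need not come from one.
  let B : E →L[ℝ] E →L[ℝ] ℝ :=
    c • (innerSL ℝ).bilinearComp e.toContinuousLinearMap e.toContinuousLinearMap
  have hBv : ∀ v w, B v w = c * inner ℝ (e v) (e w) := fun v w => rfl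
  have hpos : ∀ v, v ≠ 0 → 0 < c * B v v := by
    intro v hv
    rw [hBv, ← mul_assoc]
    have : e v ≠ 0 := fun h => hv (by simpa using h)
    have h4 : 0 < inner ℝ (e v) (e v) := real_inner_self_pos.2 this
    have h5 : 0 < c * c := mul_self_pos.2 hc
    positivity
  have hB' : ∀ v, v ≠ 0 → B v v ≠ 0 := by
    intro v hv h
    have := hpos v hv
    rw [h, mul_zero] at this
    exact lt_irrefl _ this
  refine ⟨twistedMetric h2' B (fun v w => by rw [hBv, hBv, real_inner_comm]) hB',
    twistedMetric_isCartanSchouten h2' B _ hB', fun g v hv => ?_⟩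
  exact hpos (twistedTriv (E := E) g v) fun h => hv (twistedTriv_injective h2' g v h)

end

end CartanSchouten

end

/-! ### The equivalences, with c = 1 and c = -1 for the two signs -/

theorem mainTheorem4
    {E : Type*} [NormedAddCommGroup E] [NormedSpace ℝ E] [FiniteDimensional ℝ E] [CompleteSpace E]
    {G : Type*} [TopologicalSpace G] [ChartedSpace E G] [Group G] [LieGroup 𝓘(ℝ, E) ∞ G]
    (hsolv : LieAlgebra.IsSolvable (GroupLieAlgebra 𝓘(ℝ, E) G))
    (hna : ¬ IsLieAbelian (GroupLieAlgebra 𝓘(ℝ, E) G)) :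
    ((∃ μ : CartanSchouten.Metric E G, μ.IsCartanSchouten ∧ μ.IsPositiveDefinite) ↔
      CartanSchouten.IsTwoStepNilpotent (GroupLieAlgebra 𝓘(ℝ, E) G)) ∧
    ((∃ μ : CartanSchouten.Metric E G, μ.IsCartanSchouten ∧ μ.IsNegativeDefinite) ↔
      CartanSchouten.IsTwoStepNilpotent (GroupLieAlgebra 𝓘(ℝ, E) G)) := by
  refine ⟨⟨?_, ?_⟩, ⟨?_, ?_⟩⟩
  · rintro ⟨μ, hμ, hpos⟩
    refine ⟨hna, hμ.derived_le_center 1 fun v hv => ?_⟩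
    rw [one_mul]
    exact hpos 1 v hv
  · rintro ⟨-, h⟩
    obtain ⟨μ, hμ, hpos⟩ := CartanSchouten.exists_isCartanSchouten_of_derived_le_center h 1
      one_ne_zero
    exact ⟨μ, hμ, fun g v hv => by simpa using hpos g v hv⟩
  · rintro ⟨μ, hμ, hneg⟩
    refine ⟨hna, hμ.derived_le_center (-1) fun v hv => ?_⟩
    have := hneg 1 v hv
    linarith
  · rintro ⟨-, h⟩
    obtain ⟨μ, hμ, hneg⟩ := CartanSchouten.exists_isCartanSchouten_of_derived_le_center h (-1)
      (by norm_num)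
    refine ⟨μ, hμ, fun g v hv => ?_⟩
    have := hneg g v hv
    linarith
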